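/- All posets are finite. In a poset $P$, $x\prec y$ means that $y$ covers $x$. $\mathrm{Irr}(P)$ is the set of elements with at most one lower cover and at most one upper cover, $\mathrm{Irr}^*(P)$ the set of elements with exactly one lower and exactly one upper cover, and $\mathrm{Red}(P)=P\setminus \mathrm{Irr}(P)$. The nullity of $P$ is $e-v+c$, where $e$, $v$, $c$ are the numbers of edges, vertices and connected components of its cover graph. An element $x\in \mathrm{Irr}(P)$ is retractible if either there are no $y,z\in \mathrm{Red}(P)$ with $y\prec x\prec z$, or there are such $y,z$ and no other directed path from $y$ to $z$ in $P$. A basic retract associated to $P$ is obtained by successively removing retractible elements of $\mathrm{Irr}^*$ until no element of $\mathrm{Irr}^*$ is retractible; the basic block associated to $P$ is obtained from it by successively removing all pendant vertices of the cover graph. An element $a$ of a lattice is reducible if $a=b\wedge c$ (meet-reducible) or $a=b\vee c$ (join-reducible) for some $b,c\neq a$. A block is a finite lattice whose least element is meet-reducible and whose greatest element is join-reducible. Let $\mathscr{B}(j;4,3)$ be the class of blocks on $j$ elements, up to isomorphism, that have exactly four reducible elements, these being pairwise comparable, and that have nullity three. Let $\mathscr{B}(j;4,3,6)$ be the subclass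 of those whose associated basic block has height six (a longest chain has six coverings). Let $B_{22}$ be the $10$-element lattice formed by a chain $0\prec x\prec a\prec y\prec b\prec z\prec 1$ and three further elements $c_1,c_2,c_3$ whose only covering relations are $0\prec c_1\prec a$, $a\prec c_2\prec b$, $b\prec c_3\prec 1$, and let $\mathbb{B}_{22}(j;4,3)$ be the subclass of those members of $\mathscr{B}(j;4,3)$ whose associated basic block is isomorphic to $B_{22}$. Let $P_n^k$ be the number of partitions of $n$ into exactly $k$ positive integer parts. **Proposition.** For every integer $j\ge 10$, $$|\mathscr{B}(j;4,3,6)|=|\mathbb{B}_{22}(j;4,3)|=\sum_{p=7}^{j-3}\sum_{l=4}^{p-3}P^2_{j-p-1}\,P^2_{l-2}\,P^2_{p-l-1}.$$ -/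

import Mathlib

namespace LatticeCount

section Posets

variable {P : Type*} [PartialOrder P]

/-- `x` is doubly irreducible in the poset `P` (`x ∈ Irr(P)`): it has at most one lower cover and
at most one upper cover. -/
def IsIrr (x : P) : Prop :=
  {y : P | y ⋖ x}.Subsingleton ∧ {z : P | x ⋖ z}.Subsingleton

/-- `x` belongs to `Red(P)`, the complement of `Irr(P)`. -/
def IsRed (x : P) : Prop := ¬ IsIrr x

/-- `x ∈ Irr*(P)`: `x` has exactly one lower cover and exactly one upper cover. -/
def IsIrrStar (x : P) : Prop := (∃! y : P, y ⋖ x) ∧ (∃! z : P, x ⋖ z)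

/-- `l` lists the vertices of a directed path from `y` to `z` in the cover graph of `P`. -/
def IsDirectedPath (y z : P) (l : List P) : Prop :=
  l.IsChain (· ⋖ ·) ∧ l.head? = some y ∧ l.getLast? = some z

/-- `x ∈ Irr(P)` is retractible if either there are no `y, z ∈ Red(P)` with `y ⋖ x ⋖ z`, or there
are such `y, z` and no directed path from `y` to `z` other than `y ⋖ x ⋖ z`. -/
def IsRetractible (x : P) : Prop :=
  IsIrr x ∧
    ((¬ ∃ y z : P, IsRed y ∧ IsRed z ∧ y ⋖ x ∧ x ⋖ z) ∨
      (∃ y z : P, IsRed y ∧ IsRed z ∧ y ⋖ x ∧ x ⋖ z ∧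
        ∀ l : List P, IsDirectedPath y z l → l = [y, x, z]))

/-- `x` is a pendant vertex of the cover graph of `P`: it has exactly one neighbour. -/
def IsPendant (x : P) : Prop := ∃! y : P, (SimpleGraph.hasse P).Adj x y

end Posets

/-- A poset is a basic retract if no element of `Irr*(P)` is retractible. -/
def IsBasicRetract (P : Type*) [PartialOrder P] : Prop :=
  ∀ x : P, IsIrrStar x → ¬ IsRetractible x

/-- The nullity of a finite poset: `|E| - |V| + c` for its cover graph, with `c` the number of
connected components. -/
noncomputable def nullity (P : Type*) [PartialOrder P] : ℤ :=
  ((SimpleGraph.hasse P).edgeSet.ncard : ℤ) - (Nat.card P : ℤ)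
    + (Nat.card (SimpleGraph.hasse P).ConnectedComponent : ℤ)

section AssociatedBlock

variable {P : Type*} [PartialOrder P]

/-- One removal step: `T` is the subposet `S` of `P` without one element of `Irr*(S)` that is
retractible in `S`. -/
def RetractStep (S T : Set P) : Prop :=
  ∃ x : S, IsIrrStar x ∧ IsRetractible x ∧ T = S \ {(x : P)}

/-- One removal step: `T` is the subposet `S` of `P` without one pendant vertex of `S`. -/
def PendantStep (S T : Set P) : Prop :=
  ∃ x : S, IsPendant x ∧ T = S \ {(x : P)}

/-- The subposet `R` is a basic retract associated to `P`: a basic retract obtained from `P` by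
successive removal of retractible elements of `Irr*`. -/
def IsAssociatedBasicRetract (R : Set P) : Prop :=
  Relation.ReflTransGen RetractStep Set.univ R ∧ IsBasicRetract R

/-- The subposet `B` is a basic block associated to `P`: it is obtained from a basic retract
associated to `P` by successive removal of all the pendant vertices. -/
def IsAssociatedBasicBlock (B : Set P) : Prop :=
  ∃ R : Set P, IsAssociatedBasicRetract R ∧
    Relation.ReflTransGen PendantStep R B ∧ ∀ x : B, ¬ IsPendant x

end AssociatedBlock

section Lattices

variable {L : Type*} [Lattice L]

/-- `a` is meet-reducible in the lattice `L`. -/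
def IsMeetReducible (a : L) : Prop := ∃ b c : L, b ≠ a ∧ c ≠ a ∧ b ⊓ c = a

/-- `a` is join-reducible in the lattice `L`. -/
def IsJoinReducible (a : L) : Prop := ∃ b c : L, b ≠ a ∧ c ≠ a ∧ b ⊔ c = a

end Lattices

/-- The set of reducible elements of a lattice. -/
def redSet (L : Type*) [Lattice L] : Set L := {a | IsMeetReducible a ∨ IsJoinReducible a}

/-- A block: a lattice with a least element, which is meet-reducible, and a largest element, which
is join-reducible (used for finite lattices). -/
def IsBlock (L : Type*) [Lattice L] : Prop :=
  (∃ a : L, IsBot a ∧ IsMeetReducible a) ∧ (∃ a : L, IsTop a ∧ IsJoinReducible a)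

/-- `L` is a block with exactly `r` reducible elements, which are pairwise comparable, and with
nullity `k`. -/
def IsBlockWith (L : Type*) [Lattice L] (r k : ℕ) : Prop :=
  IsBlock L ∧ (redSet L).ncard = r ∧ IsChain (· ≤ ·) (redSet L) ∧ nullity L = (k : ℤ)

/-- The basic block associated to `L` has height `h` (the length of a longest chain, in terms of
the number of coverings). -/
def HasBasicBlockOfHeight (L : Type*) [Lattice L] (h : ℕ) : Prop :=
  ∃ B : Set L, IsAssociatedBasicBlock B ∧ Order.krullDim B = (h : WithBot ℕ∞)

/-- The poset `Q` is (up to isomorphism) the basic block associated to `L`. -/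
def HasBasicBlock (L : Type*) [Lattice L] (Q : Type*) [PartialOrder Q] : Prop :=
  ∃ B : Set L, IsAssociatedBasicBlock B ∧ Nonempty (B ≃o Q)

/-- The ten elements of the basic block `B₂₂`: the `7`-chain `0 ⋖ x ⋖ a ⋖ y ⋖ b ⋖ z ⋖ 1` and
three further elements `c₁`, `c₂`, `c₃`, with `0 ⋖ c₁ ⋖ a`, `a ⋖ c₂ ⋖ b`, `b ⋖ c₃ ⋖ 1`. -/
inductive B22 : Type
  | zero | x | c1 | a | y | c2 | b | z | c3 | one

/-- The level of an element of `B₂₂` in its diagram. -/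
def B22.level : B22 → ℕ
  | .zero => 0
  | .x => 1
  | .c1 => 1
  | .a => 2
  | .y => 3
  | .c2 => 3
  | .b => 4
  | .z => 5
  | .c3 => 5
  | .one => 6

/-- The order of `B₂₂`: any two elements on different levels are comparable, the lower one being
the smaller, and two different elements on the same level are incomparable. -/
instance B22.instPartialOrder : PartialOrder B22 where
  le u v := u = v ∨ u.level < v.level
  le_refl _ := Or.inl rfl
  le_trans u v w huv hvw := by
    rcases huv with rfl | huv
    · exact hvw
    · rcases hvw with rfl | hvw
      · exact Or.inr huv
      · exact Or.inr (huv.trans hvw)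
  le_antisymm u v huv hvu := by
    rcases huv with rfl | huv
    · rfl
    · rcases hvu with h | hvu
      · exact h.symm
      · exact absurd (huv.trans hvu) (lt_irrefl _)

/-- Two lattice structures on `{0, …, n-1}` are identified when the lattices are isomorphic. -/
def isoSetoid (n : ℕ) : Setoid (Lattice (Fin n)) where
  r L₁ L₂ := Nonempty (@OrderIso (Fin n) (Fin n) L₁.toLE L₂.toLE)
  iseqv :=
    { refl := fun L => ⟨@OrderIso.refl (Fin n) L.toLE⟩
      symm := fun {L₁ L₂} ⟨e⟩ => ⟨@OrderIso.symm (Fin n) (Fin n) L₁.toLE L₂.toLE e⟩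
      trans := fun {L₁ L₂ L₃} ⟨e⟩ ⟨f⟩ =>
        ⟨@OrderIso.trans (Fin n) (Fin n) (Fin n) L₁.toLE L₂.toLE L₃.toLE e f⟩ }

/-- The number of isomorphism classes of lattices in a class `C` of lattices on `n` elements. -/
noncomputable def numUpToIso {n : ℕ} (C : Set (Lattice (Fin n))) : ℕ :=
  ((Quotient.mk (isoSetoid n)) '' C).ncard

/-- `𝓑(j; r, k)`: blocks on `j` elements with `r` reducible elements, all comparable, and nullity
`k`. -/
def blocks (j r k : ℕ) : Set (Lattice (Fin j)) :=
  {L | @IsBlockWith (Fin j) L r k}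

/-- `𝓑(j; r, k, h)`: the members of `𝓑(j; r, k)` whose associated basic block has height `h`. -/
def blocksOfHeight (j r k h : ℕ) : Set (Lattice (Fin j)) :=
  {L | L ∈ blocks j r k ∧ @HasBasicBlockOfHeight (Fin j) L h}

/-- `𝔹₂₂(j; 4, 3)`: the members of `𝓑(j; 4, 3)` whose associated basic block is `B₂₂`. -/
def blocksB22 (j : ℕ) : Set (Lattice (Fin j)) :=
  {L | L ∈ blocks j 4 3 ∧ @HasBasicBlock (Fin j) L B22 B22.instPartialOrder}

/-- `P_n^k`: the number of partitions of `n` into exactly `k` positive integer parts. -/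
def numPartitions (n k : ℕ) : ℕ :=
  (Finset.univ.filter fun π : n.Partition => π.parts.card = k).card

end LatticeCount

open LatticeCount

namespace LatticeCount

/-! ### Covers in finite posets. -/

section FinitePosets

variable {P : Type*} [PartialOrder P]

/-! Both classes consist of the lattices obtained from `B22` by stretching its six doubly
irreducible elements into nonempty chains: four reducible elements `r₀ < r₁ < r₂ < r₃`, with two
mutually incomparable chains filling each of the three gaps. Such a structure is recorded by a map
to `B22` satisfying `IsBlowup`, and `blocksOfHeight_eq` and `blocksB22_eq` reduce both classes to
the existence of such a map.

From height six to a blowup (`exists_isBlowup`): a chain of seven elements in the basic block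
contains at least three irreducible ones. None of these can be retracted, so each lies between two
reducible elements that are also joined by another path. As only four elements are reducible, these
three intervals are the three consecutive gaps, and each gap contains an incomparable pair. Hence
`r₀`, `r₁`, `r₂` have at least two upper covers each; nullity three leaves room for exactly two.
Meets and joins of incomparable elements are reducible and cannot lie strictly inside a gap, so each
gap consists of two chains.

Conversely, the covers of a blowup can be read off from levels, which gives the block conditions
(`IsBlowup.isBlockWith`). Removing retractible elements never empties a fibre and stops only when
every fibre is a singleton, that is, at `B22` (`IsBlowup.hasBasicBlock`).

For the count, levels are intrinsic to the poset, so the only freedom in the map is to swap the two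
chains of a gap. Isomorphism classes therefore correspond to fibre sizes with each pair sorted
(`numUpToIso_blowups`). A gap with `m` elements contributes the number of partitions of `m` into two
parts, and summing over gap sizes of total `j - 4` gives the formula (`ncard_fiberSizes`). -/

theorem reflTransGen_covBy_of_le [Finite P] {u v : P} (h : u ≤ v) :
    Relation.ReflTransGen (· ⋖ ·) u v := by
  induction u using WellFoundedGT.induction with
  | ind u ih =>
    rcases h.eq_or_lt with rfl | h
    · exact .refl
    · obtain ⟨w, huw, hwv⟩ := exists_covBy_le_of_lt h
      exact .head huw (ih w huw.lt hwv)

/-- The right-hand side mentions only the order, so it can be followed when an element is deleted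
and the cover relation changes. -/
theorem existsUnique_covBy_iff [Finite P] {u : P} :
    (∃! w, u ⋖ w) ↔ ∃ w, u < w ∧ ∀ v, u < v → w ≤ v := by
  constructor
  · rintro ⟨w, hw, huniq⟩
    refine ⟨w, hw.lt, fun v hv => ?_⟩
    obtain ⟨c, hc, hcv⟩ := exists_covBy_le_of_lt hv
    rwa [← huniq c hc]
  · rintro ⟨w, hw, hmin⟩
    refine ⟨w, ⟨hw, fun c hc hcw => (hmin c hc).not_gt hcw⟩, fun c hc => ?_⟩
    by_contra hne
    exact hc.2 hw (lt_of_le_of_ne (hmin c hc.lt) (Ne.symm hne))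

theorem existsUnique_covBy_iff' [Finite P] {u : P} :
    (∃! w, w ⋖ u) ↔ ∃ w, w < u ∧ ∀ v, v < u → v ≤ w := by
  have h := existsUnique_covBy_iff (P := Pᵒᵈ) (u := OrderDual.toDual u)
  simpa [ExistsUnique, OrderDual.exists, OrderDual.forall] using h

theorem IsIrrStar.isIrr {x : P} (h : IsIrrStar x) : IsIrr x :=
  ⟨fun _ ha _ hb => h.1.unique ha hb, fun _ ha _ hb => h.2.unique ha hb⟩

theorem covBy_incomparable {u v w : P} (hv : u ⋖ v) (hw : u ⋖ w) (hne : v ≠ w) :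
    ¬ v ≤ w ∧ ¬ w ≤ v :=
  ⟨fun h => hw.2 hv.lt (lt_of_le_of_ne h hne), fun h => hv.2 hw.lt (lt_of_le_of_ne h hne.symm)⟩

end FinitePosets

/-! ### Levels and symmetries of `B22`. -/

namespace B22

instance : DecidableEq B22 := fun s t => by
  cases s <;> cases t <;> first | exact isTrue rfl | exact isFalse (fun h => B22.noConfusion h)

instance : Fintype B22 where
  elems := {.zero, .x, .c1, .a, .y, .c2, .b, .z, .c3, .one}
  complete t := by cases t <;> decide

theorem le_iff {s t : B22} : s ≤ t ↔ s = t ∨ s.level < t.level := Iff.rfl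

theorem lt_iff {s t : B22} : s < t ↔ s.level < t.level := by
  rw [lt_iff_le_and_ne, le_iff]
  constructor
  · rintro ⟨h | h, hne⟩
    · exact absurd h hne
    · exact h
  · intro h
    exact ⟨Or.inr h, fun he => by simp [he] at h⟩

theorem level_le_of_le {s t : B22} (h : s ≤ t) : s.level ≤ t.level := by
  rcases h with rfl | h
  · exact le_rfl
  · exact h.le

theorem level_le_six (t : B22) : t.level ≤ 6 := by cases t <;> decide

theorem eq_of_even {s t : B22} (h : s.level = t.level) (he : Even s.level) : s = t := by
  revert s t; decide

theorem exists_level {k : ℕ} (hk : k ≤ 6) : ∃ t : B22, t.level = k := by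
  interval_cases k
  exacts [⟨.zero, rfl⟩, ⟨.x, rfl⟩, ⟨.a, rfl⟩, ⟨.y, rfl⟩, ⟨.b, rfl⟩, ⟨.z, rfl⟩, ⟨.one, rfl⟩]

/-- The other element on the level of an element of `B₂₂`, if there is one. -/
def sibling : B22 → B22
  | .zero => .zero
  | .x => .c1
  | .c1 => .x
  | .a => .a
  | .y => .c2
  | .c2 => .y
  | .b => .b
  | .z => .c3
  | .c3 => .z
  | .one => .one

theorem level_sibling (t : B22) : t.sibling.level = t.level := by cases t <;> rfl

theorem sibling_ne {t : B22} (h : Odd t.level) : t.sibling ≠ t := by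
  revert t; decide

theorem eq_or_eq_sibling {s t : B22} (h : s.level = t.level) : s = t ∨ s = t.sibling := by
  revert s t; decide

/-- The order-reversing involution of `B₂₂` that reflects its diagram. -/
def dual : B22 → B22
  | .zero => .one
  | .x => .z
  | .c1 => .c3
  | .a => .b
  | .y => .y
  | .c2 => .c2
  | .b => .a
  | .z => .x
  | .c3 => .c1
  | .one => .zero

theorem dual_dual (t : B22) : t.dual.dual = t := by cases t <;> rfl

theorem level_dual (t : B22) : t.dual.level = 6 - t.level := by cases t <;> rfl

theorem dual_injective : Function.Injective dual :=
  Function.LeftInverse.injective dual_dual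

end B22

/-- `f` presents `P` as the poset obtained from `B₂₂` by replacing each doubly irreducible element
by a nonempty chain. -/
structure IsBlowup {P : Type*} [PartialOrder P] (f : P → B22) : Prop where
  surj : Function.Surjective f
  mono : Monotone f
  lt_of_level_lt : ∀ {u v}, (f u).level < (f v).level → u < v
  total : ∀ {u v}, f u = f v → u ≤ v ∨ v ≤ u
  eq_of_even : ∀ {u v}, f u = f v → Even (f u).level → u = v

/-! ### Covers and reducible elements of a blowup. -/

namespace IsBlowup

variable {P : Type*} [PartialOrder P] {f : P → B22}

/-- Since `B22` is self-dual, results on upper covers and lower bounds transfer to lower covers and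
upper bounds. -/
theorem dual (hf : IsBlowup f) : IsBlowup fun u : Pᵒᵈ => (f (OrderDual.ofDual u)).dual where
  surj t := by
    obtain ⟨u, hu⟩ := hf.surj t.dual
    exact ⟨OrderDual.toDual u, by simp [hu, B22.dual_dual]⟩
  mono u v h := by
    rcases hf.mono (OrderDual.ofDual_le_ofDual.2 h) with h | h
    · exact Or.inl (by simp only [h])
    · refine Or.inr ?_
      have := B22.level_le_six (f (OrderDual.ofDual u))
      simp only [B22.level_dual]; omega
  lt_of_level_lt {u v} h := by
    simp only [B22.level_dual] at h
    exact OrderDual.ofDual_lt_ofDual.1 (hf.lt_of_level_lt (by omega))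
  total {u v} h := (hf.total (B22.dual_injective h)).symm
  eq_of_even {u v} h he := by
    refine OrderDual.ofDual.injective (hf.eq_of_even (B22.dual_injective h) ?_)
    have := B22.level_le_six (f (OrderDual.ofDual u))
    simp only [B22.level_dual] at he
    rw [Nat.even_iff] at he ⊢; omega

theorem level_mono (hf : IsBlowup f) {u v : P} (h : u ≤ v) : (f u).level ≤ (f v).level :=
  B22.level_le_of_le (hf.mono h)

theorem eq_of_level_eq (hf : IsBlowup f) {u v : P} (h : (f u).level = (f v).level)
    (he : Even (f u).level) : u = v :=
  hf.eq_of_even (B22.eq_of_even h he) he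

theorem le_of_level_le (hf : IsBlowup f) {u v : P} (h : (f u).level ≤ (f v).level)
    (he : Even (f u).level) : u ≤ v := by
  rcases h.eq_or_lt with h | h
  · exact (hf.eq_of_level_eq h he).le
  · exact (hf.lt_of_level_lt h).le

theorem level_lt (hf : IsBlowup f) {u v : P} (h : u < v) (he : Even (f u).level) :
    (f u).level < (f v).level :=
  lt_of_le_of_ne (hf.level_mono h.le) fun h' => h.ne (hf.eq_of_level_eq h' he)

theorem exists_of_level (hf : IsBlowup f) {k : ℕ} (hk : k ≤ 6) : ∃ u, (f u).level = k := by
  obtain ⟨t, ht⟩ := B22.exists_level hk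
  obtain ⟨u, rfl⟩ := hf.surj t
  exact ⟨u, ht⟩

theorem not_le_of_ne (hf : IsBlowup f) {u v : P} (hl : (f u).level = (f v).level)
    (hne : f u ≠ f v) : ¬ u ≤ v := fun h => by
  rcases hf.mono h with h | h
  · exact hne h
  · omega

/-- Different levels are comparable, fibres are chains and even levels are singletons; only the two
fibres of one odd level remain. -/
theorem incomparable (hf : IsBlowup f) {u v : P} (huv : ¬ u ≤ v) (hvu : ¬ v ≤ u) :
    (f u).level = (f v).level ∧ f u ≠ f v ∧ Odd (f u).level := by
  have hl : (f u).level = (f v).level := by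
    rcases lt_trichotomy (f u).level (f v).level with h | h | h
    · exact absurd (hf.lt_of_level_lt h).le huv
    · exact h
    · exact absurd (hf.lt_of_level_lt h).le hvu
  refine ⟨hl, fun h => (hf.total h).elim huv hvu, ?_⟩
  by_contra ho
  exact huv (hf.eq_of_level_eq hl (Nat.not_odd_iff_even.1 ho)).le

theorem existsUnique_covBy [Finite P] (hf : IsBlowup f) {u : P} (ho : Odd (f u).level) :
    ∃! w, u ⋖ w := by
  have h6 := B22.level_le_six (f u)
  obtain ⟨v, hv⟩ := hf.exists_of_level le_rfl
  obtain ⟨w, hw, -⟩ := exists_covBy_le_of_lt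
    (hf.lt_of_level_lt (u := u) (v := v) (by rw [Nat.odd_iff] at ho; omega))
  refine ⟨w, hw, fun w' hw' => ?_⟩
  by_contra hne
  obtain ⟨h1, h2⟩ := covBy_incomparable hw' hw hne
  obtain ⟨hl, hne', hodd⟩ := hf.incomparable h1 h2
  have hle := hf.level_mono hw'.le
  rcases hle.eq_or_lt with h | h
  · have e1 : f u = f w := (hf.mono hw.le).resolve_right (by omega)
    have e2 : f u = f w' := (hf.mono hw'.le).resolve_right (by omega)
    exact hne' (e2.symm.trans e1)
  -- Both levels are odd here, so the element of the even level just above `u` separates `u` from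
  -- its supposed cover.
  · have := B22.level_le_six (f w)
    obtain ⟨e, he⟩ := hf.exists_of_level (k := (f u).level + 1) (by omega)
    rw [Nat.odd_iff] at ho hodd
    exact hw.2 (hf.lt_of_level_lt (u := u) (v := e) (by omega)) (hf.lt_of_level_lt (by omega))

theorem existsUnique_covBy' [Finite P] (hf : IsBlowup f) {u : P} (ho : Odd (f u).level) :
    ∃! w, w ⋖ u := by
  have h := hf.dual.existsUnique_covBy (u := OrderDual.toDual u) (by
    have := B22.level_le_six (f u)
    simp only [B22.level_dual, OrderDual.ofDual_toDual]
    rw [Nat.odd_iff] at ho ⊢; omega)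
  simpa [ExistsUnique, OrderDual.exists, OrderDual.forall] using h

theorem isIrrStar [Finite P] (hf : IsBlowup f) {u : P} (ho : Odd (f u).level) : IsIrrStar u :=
  ⟨hf.existsUnique_covBy' ho, hf.existsUnique_covBy ho⟩

theorem level_covBy (hf : IsBlowup f) {u w : P} (he : Even (f u).level) (h : u ⋖ w) :
    (f w).level = (f u).level + 1 := by
  have hlt := hf.level_lt h.lt he
  by_contra hne
  have := B22.level_le_six (f w)
  obtain ⟨e, he⟩ := hf.exists_of_level (k := (f u).level + 1) (by omega)
  exact h.2 (hf.lt_of_level_lt (u := u) (v := e) (by omega)) (hf.lt_of_level_lt (by omega))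

theorem exists_covBy [Finite P] (hf : IsBlowup f) {u : P} (he : Even (f u).level) {t : B22}
    (ht : t.level = (f u).level + 1) : ∃ w, u ⋖ w ∧ f w = t := by
  obtain ⟨v, rfl⟩ := hf.surj t
  obtain ⟨w, huw, hwv⟩ := exists_covBy_le_of_lt (hf.lt_of_level_lt (u := u) (v := v) (by omega))
  have := hf.level_covBy he huw
  exact ⟨w, huw, (hf.mono hwv).resolve_right (by omega)⟩

/-- Each of the two fibres on the next level supplies one cover, and only one because a fibre is a
chain. -/
theorem ncard_covBy [Finite P] (hf : IsBlowup f) {u : P} (he : Even (f u).level)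
    (h6 : (f u).level ≠ 6) : {w | u ⋖ w}.ncard = 2 := by
  have := B22.level_le_six (f u)
  obtain ⟨t, ht⟩ := B22.exists_level (k := (f u).level + 1) (by omega)
  obtain ⟨v, hv, hvt⟩ := hf.exists_covBy he ht
  obtain ⟨w, hw, hwt⟩ := hf.exists_covBy he (t := t.sibling) (by rw [B22.level_sibling, ht])
  have hne : t.sibling ≠ t := B22.sibling_ne (by rw [ht]; exact he.add_one)
  rw [Set.ncard_eq_two]
  refine ⟨v, w, fun h => hne (by rw [← hwt, ← h, hvt]), Set.ext fun c => ⟨fun hc => ?_, ?_⟩⟩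
  · have hl := hf.level_covBy he hc
    have key : ∀ d, u ⋖ d → f c = f d → c = d := fun d hd hcd => by
      by_contra hne
      obtain ⟨h1, h2⟩ := covBy_incomparable hc hd hne
      exact (hf.incomparable h1 h2).2.1 hcd
    rcases B22.eq_or_eq_sibling (hl.trans ht.symm) with h | h
    · exact Or.inl (key v hv (h.trans hvt.symm))
    · exact Or.inr (key w hw (h.trans hwt.symm))
  · rintro (rfl | rfl)
    exacts [hv, hw]

theorem ncard_covBy' [Finite P] (hf : IsBlowup f) {u : P} (he : Even (f u).level)
    (h0 : (f u).level ≠ 0) : {w | w ⋖ u}.ncard = 2 := by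
  have h6 := B22.level_le_six (f u)
  have h := hf.dual.ncard_covBy (u := OrderDual.toDual u)
    (by
      simp only [B22.level_dual, OrderDual.ofDual_toDual]
      rw [Nat.even_iff] at he ⊢; omega)
    (by
      simp only [B22.level_dual, OrderDual.ofDual_toDual]; omega)
  rw [← h]
  refine Set.ncard_congr (fun w _ => OrderDual.toDual w) (fun w hw => ?_) (fun _ _ _ _ h => h)
    (fun w hw => ⟨OrderDual.ofDual w, ?_, rfl⟩)
  · exact toDual_covBy_toDual_iff.2 hw
  · exact ofDual_covBy_ofDual_iff.2 hw

theorem isRed_of_even [Finite P] (hf : IsBlowup f) {u : P} (he : Even (f u).level) : IsRed u := by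
  intro h
  by_cases h6 : (f u).level = 6
  · have h2 := hf.ncard_covBy' he (by omega)
    have := Set.ncard_le_one_iff_subsingleton.2 h.1
    omega
  · have h2 := hf.ncard_covBy he h6
    have := Set.ncard_le_one_iff_subsingleton.2 h.2
    omega

theorem isRed_iff [Finite P] (hf : IsBlowup f) {u : P} : IsRed u ↔ Even (f u).level :=
  ⟨fun h => by
    by_contra ho
    exact h (hf.isIrrStar (Nat.not_even_iff_odd.1 ho)).isIrr, hf.isRed_of_even⟩

end IsBlowup

/-! ### Directed paths through a given element. -/

section Paths

variable {P : Type*} [PartialOrder P]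

theorem IsDirectedPath.exists_of_reflTransGen {y s z : P} {l : List P}
    (hl : IsDirectedPath s z l) (h : Relation.ReflTransGen (· ⋖ ·) y s) :
    ∃ l' : List P, IsDirectedPath y z l' ∧ ∀ c ∈ l, c ∈ l' := by
  induction h using Relation.ReflTransGen.head_induction_on with
  | refl => exact ⟨l, hl, fun _ h => h⟩
  | @head a c hac _ ih =>
    obtain ⟨l', ⟨hch, hhead, hlast⟩, hmem⟩ := ih
    cases l' with
    | nil => simp at hhead
    | cons d l' =>
      obtain rfl : d = c := by simpa using hhead
      exact ⟨a :: d :: l', ⟨List.isChain_cons_cons.2 ⟨hac, hch⟩, rfl, by simpa using hlast⟩,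
        fun e he => List.mem_cons_of_mem _ (hmem e he)⟩

theorem exists_isDirectedPath_mem [Finite P] {y s z : P} (hys : y ≤ s) (hsz : s ≤ z) :
    ∃ l : List P, IsDirectedPath y z l ∧ s ∈ l := by
  have hz : IsDirectedPath z z [z] := ⟨List.isChain_singleton _, rfl, rfl⟩
  obtain ⟨l, hl, -⟩ := hz.exists_of_reflTransGen (reflTransGen_covBy_of_le hsz)
  obtain ⟨l', hl', hmem⟩ := hl.exists_of_reflTransGen (reflTransGen_covBy_of_le hys)
  exact ⟨l', hl', hmem s (List.mem_of_mem_head? hl.2.1)⟩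

end Paths

/-! ### Retracting a blowup to `B22`. -/

namespace IsBlowup

variable {P : Type*} [PartialOrder P] {f : P → B22}

theorem restrict (hf : IsBlowup f) {S : Set P} (hS : ∀ t, ∃ u ∈ S, f u = t) :
    IsBlowup fun u : S => f u where
  surj t := by
    obtain ⟨u, hu, rfl⟩ := hS t
    exact ⟨⟨u, hu⟩, rfl⟩
  mono _ _ h := hf.mono h
  lt_of_level_lt h := hf.lt_of_level_lt h
  total h := hf.total h
  eq_of_even h he := Subtype.ext (hf.eq_of_even h he)

/-- An irreducible element alone in its fibre is adjacent to the reducible elements just below and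
above, and the sibling fibre carries a second path between them. So retraction never empties a
fibre. -/
theorem exists_ne_of_isRetractible [Finite P] (hf : IsBlowup f) {x : P} (hx : IsRetractible x) :
    ∃ u, u ≠ x ∧ f u = f x := by
  by_contra hcon
  push Not at hcon
  have huniq : ∀ u, f u = f x → u = x := fun u hu => by
    by_contra hne
    exact hcon u hne hu
  have ho : Odd (f x).level := Nat.not_even_iff_odd.1 fun he => hf.isRed_of_even he hx.1
  have h6 := B22.level_le_six (f x)
  have ho' := Nat.odd_iff.1 ho
  rcases hx.2 with h | ⟨y, z, hy, hz, hyx, hxz, hpath⟩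
  · obtain ⟨y, hy⟩ := hf.exists_of_level (k := (f x).level - 1) (by omega)
    obtain ⟨z, hz⟩ := hf.exists_of_level (k := (f x).level + 1) (by omega)
    have hye : Even (f y).level := by rw [Nat.even_iff]; omega
    have hze : Even (f z).level := by rw [Nat.even_iff]; omega
    refine h ⟨y, z, hf.isRed_of_even hye, hf.isRed_of_even hze,
      ⟨hf.lt_of_level_lt (by omega), fun c hyc hcx => ?_⟩,
      ⟨hf.lt_of_level_lt (by omega), fun c hxc hcz => ?_⟩⟩
    · have := hf.level_lt hyc hye
      exact hcx.ne (huniq c ((hf.mono hcx.le).resolve_right (by omega)))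
    · have h1 := hf.level_mono hxc.le
      rcases hf.mono hcz.le with h | h
      · exact hcz.ne (hf.eq_of_even h (by rw [h]; exact hze))
      · exact hxc.ne (huniq c ((hf.mono hxc.le).resolve_right (by omega)).symm).symm
  · rw [hf.isRed_iff] at hy hz
    have h1 := hf.level_covBy hy hyx
    have h2 := hf.level_mono hxz.le
    rw [Nat.even_iff] at hy hz
    obtain ⟨s, hs⟩ := hf.surj (f x).sibling
    have hsl : (f s).level = (f x).level := by rw [hs, B22.level_sibling]
    obtain ⟨l, hl, hmem⟩ := exists_isDirectedPath_mem
      (hf.lt_of_level_lt (u := y) (v := s) (by omega)).le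
      (hf.lt_of_level_lt (u := s) (v := z) (by omega)).le
    rw [hpath l hl] at hmem
    simp only [List.mem_cons, List.not_mem_nil, or_false] at hmem
    rcases hmem with rfl | rfl | rfl
    · omega
    · exact B22.sibling_ne ho hs.symm
    · omega

/-- If `u < v` share a fibre, every reducible element above `u` is also above `v`; hence no
reducible element covers `u`, and `u` is retractible by the first alternative. -/
theorem injective_of_isBasicRetract [Finite P] (hf : IsBlowup f) (hP : IsBasicRetract P) :
    Function.Injective f := by
  have key : ∀ u v, f u = f v → ¬ u < v := fun u v h hlt => by
    have ho : Odd (f u).level := Nat.not_even_iff_odd.1 fun he => hlt.ne (hf.eq_of_even h he)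
    have hst := hf.isIrrStar ho
    refine hP u hst ⟨hst.isIrr, Or.inl ?_⟩
    rintro ⟨y, z, -, hz, -, huz⟩
    rw [hf.isRed_iff, Nat.even_iff] at hz
    have := hf.level_mono huz.le
    rw [Nat.odd_iff] at ho
    exact huz.2 hlt (hf.lt_of_level_lt (by rw [← h]; omega))
  intro u v h
  by_contra hne
  rcases hf.total h with h' | h'
  · exact key u v h (lt_of_le_of_ne h' hne)
  · exact key v u h.symm (lt_of_le_of_ne h' (Ne.symm hne))

theorem nonempty_orderIso (hf : IsBlowup f) (hinj : Function.Injective f) : Nonempty (P ≃o B22) :=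
  ⟨{ Equiv.ofBijective f ⟨hinj, hf.surj⟩ with
    map_rel_iff' := fun {u v} => ⟨fun h => by
      rcases h with h | h
      · exact (hinj h).le
      · exact (hf.lt_of_level_lt h).le, fun h => hf.mono h⟩ }⟩

theorem not_isPendant [Finite P] (hf : IsBlowup f) (u : P) : ¬ IsPendant u := by
  rintro ⟨w, -, hw⟩
  simp only [SimpleGraph.hasse_adj] at hw
  by_cases he : Even (f u).level
  · by_cases h6 : (f u).level = 6
    · obtain ⟨a, b, hab, h⟩ := Set.ncard_eq_two.1 (hf.ncard_covBy' he (by omega))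
      have ha : a ∈ {w | w ⋖ u} := by rw [h]; simp
      have hb : b ∈ {w | w ⋖ u} := by rw [h]; simp
      exact hab ((hw a (Or.inr ha)).trans (hw b (Or.inr hb)).symm)
    · obtain ⟨a, b, hab, h⟩ := Set.ncard_eq_two.1 (hf.ncard_covBy he h6)
      have ha : a ∈ {w | u ⋖ w} := by rw [h]; simp
      have hb : b ∈ {w | u ⋖ w} := by rw [h]; simp
      exact hab ((hw a (Or.inl ha)).trans (hw b (Or.inl hb)).symm)
  · obtain ⟨⟨a, ha, -⟩, ⟨b, hb, -⟩⟩ := hf.isIrrStar (Nat.not_even_iff_odd.1 he)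
    exact (ha.lt.trans hb.lt).ne ((hw a (Or.inr ha)).trans (hw b (Or.inl hb)).symm)

theorem exists_basicRetract [Finite P] (hf : IsBlowup f) (S : Set P)
    (hS : ∀ t, ∃ u ∈ S, f u = t) :
    ∃ R : Set P, Relation.ReflTransGen RetractStep S R ∧ IsBasicRetract R ∧
      ∀ t, ∃ u ∈ R, f u = t := by
  induction S using WellFoundedLT.induction with
  | ind S ih =>
    by_cases hb : IsBasicRetract S
    · exact ⟨S, .refl, hb, hS⟩
    · simp only [IsBasicRetract, not_forall, not_not] at hb
      obtain ⟨x, hx, hr⟩ := hb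
      obtain ⟨v, hvx, hv⟩ := (hf.restrict hS).exists_ne_of_isRetractible hr
      obtain ⟨R, hSR, hR⟩ := ih (S \ {(x : P)})
        (Set.ssubset_iff_subset_ne.2 ⟨Set.sdiff_subset, fun h =>
          (h.ge x.2).2 rfl⟩)
        (fun t => by
          obtain ⟨u, hu, rfl⟩ := hS t
          by_cases hux : u = x
          · subst hux
            exact ⟨v, ⟨v.2, fun h => hvx (Subtype.ext h)⟩, hv⟩
          · exact ⟨u, ⟨hu, hux⟩, rfl⟩)
      exact ⟨R, .head ⟨x, hx, hr, rfl⟩ hSR, hR⟩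

end IsBlowup

theorem IsBlowup.hasBasicBlock {L : Type*} [Lattice L] [Finite L] {f : L → B22}
    (hf : IsBlowup f) : HasBasicBlock L B22 := by
  obtain ⟨R, hR, hb, hs⟩ := hf.exists_basicRetract Set.univ
    (fun t => (hf.surj t).imp fun u hu => ⟨Set.mem_univ u, hu⟩)
  have hfR := hf.restrict hs
  -- The retract has no pendant vertices, so it is already its own basic block.
  exact ⟨R, ⟨R, ⟨hR, hb⟩, .refl, hfR.not_isPendant⟩,
    hfR.nonempty_orderIso (hfR.injective_of_isBasicRetract hb)⟩

theorem krullDim_B22 : Order.krullDim B22 = ((6 : ℕ) : WithBot ℕ∞) := by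
  apply le_antisymm
  · refine iSup_le fun p => ?_
    have h := (p.map (fun t : B22 => (⟨t.level, Nat.lt_succ_of_le (B22.level_le_six t)⟩ : Fin 7))
      fun s t h => B22.lt_iff.1 h).length_lt_card
    rw [Fintype.card_fin] at h
    exact_mod_cast Nat.le_of_lt_succ h
  · refine Order.le_krullDim_iff.2
      ⟨⟨6, ![.zero, .x, .a, .y, .b, .z, .one], fun i => B22.lt_iff.2 ?_⟩, rfl⟩
    revert i
    decide

theorem HasBasicBlock.hasBasicBlockOfHeight {L : Type*} [Lattice L] (h : HasBasicBlock L B22) :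
    HasBasicBlockOfHeight L 6 := by
  obtain ⟨B, hB, ⟨e⟩⟩ := h
  exact ⟨B, hB, (Order.krullDim_eq_of_orderIso e).trans krullDim_B22⟩

/-! ### Nullity from numbers of upper covers. -/

section Nullity

variable {P : Type*} [PartialOrder P]

theorem hasse_connected [Finite P] {b : P} (hb : IsBot b) : (SimpleGraph.hasse P).Connected := by
  have h : ∀ u, (SimpleGraph.hasse P).Reachable b u := fun u => by
    have hr := reflTransGen_covBy_of_le (hb u)
    induction hr with
    | refl => exact .refl _
    | tail _ hcv ih => exact ih.trans (SimpleGraph.Adj.reachable (Or.inl hcv))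
  exact (SimpleGraph.connected_iff_exists_forall_reachable _).2 ⟨b, h⟩

theorem ncard_edgeSet_hasse [Fintype P] :
    (SimpleGraph.hasse P).edgeSet.ncard = ∑ u : P, {w : P | u ⋖ w}.ncard := by
  classical
  have h1 : (SimpleGraph.hasse P).edgeSet = (fun p : P × P => s(p.1, p.2)) '' {p | p.1 ⋖ p.2} := by
    ext e
    induction e using Sym2.ind with
    | _ u v =>
      simp only [SimpleGraph.mem_edgeSet, SimpleGraph.hasse_adj, Set.mem_image, Set.mem_ofPred_eq,
        Prod.exists]
      constructor
      · rintro (h | h)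
        exacts [⟨u, v, h, rfl⟩, ⟨v, u, h, Sym2.eq_swap⟩]
      · rintro ⟨a, b, h, he⟩
        rcases Sym2.eq_iff.1 he with ⟨rfl, rfl⟩ | ⟨rfl, rfl⟩
        exacts [Or.inl h, Or.inr h]
  rw [h1, Set.InjOn.ncard_image]
  · rw [Set.ncard_eq_toFinset_card',
      Finset.card_eq_sum_card_fiberwise (f := Prod.fst) (t := Finset.univ) (by simp)]
    refine Finset.sum_congr rfl fun u _ => ?_
    rw [Set.ncard_eq_toFinset_card']
    refine Finset.card_nbij' Prod.snd (fun w => (u, w)) ?_ ?_ ?_ ?_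
    · rintro ⟨a, b⟩ h
      simp only [Finset.coe_filter, Set.mem_toFinset, Set.mem_ofPred_eq] at h
      simpa [← h.2] using h.1
    · intro w h
      simpa using h
    · rintro ⟨a, b⟩ h
      simp only [Finset.coe_filter, Set.mem_toFinset, Set.mem_ofPred_eq] at h
      simp [h.2]
    · intro w _
      rfl
  · rintro ⟨a, b⟩ hab ⟨c, d⟩ hcd h
    rcases Sym2.eq_iff.1 h with ⟨rfl, rfl⟩ | ⟨rfl, rfl⟩
    · rfl
    · exact absurd (CovBy.lt hab) (CovBy.lt hcd).asymm

theorem nullity_eq [Fintype P] {b : P} (hb : IsBot b) :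
    nullity P = (∑ u : P, {w : P | u ⋖ w}.ncard : ℕ) - (Fintype.card P : ℤ) + 1 := by
  have hc := hasse_connected hb
  have : Nat.card (SimpleGraph.hasse P).ConnectedComponent = 1 := by
    rw [Nat.card_eq_one_iff_unique]
    exact ⟨hc.preconnected.subsingleton_connectedComponent,
      ⟨(SimpleGraph.hasse P).connectedComponentMk b⟩⟩
  rw [nullity, this, ncard_edgeSet_hasse, Nat.card_eq_fintype_card, Nat.cast_one]

end Nullity

/-! ### Reducibility in terms of covers. -/

section Reducible

variable {L : Type*} [Lattice L]

theorem inf_eq_of_covBy {u v w : L} (hv : u ⋖ v) (hw : u ⋖ w) (hne : v ≠ w) : v ⊓ w = u := by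
  have h := covBy_incomparable hv hw hne
  refine (hv.eq_or_eq (le_inf hv.le hw.le) inf_le_left).resolve_right fun h' => h.1 ?_
  exact inf_eq_left.1 h'

/-- A single upper cover would lie below both factors of a meet equal to `u`; conversely two covers
of `u` meet in `u`. -/
theorem isMeetReducible_iff [Finite L] {u : L} :
    IsMeetReducible u ↔ ¬ {w : L | u ⋖ w}.Subsingleton := by
  constructor
  · rintro ⟨b, c, hb, hc, h⟩ hs
    obtain ⟨b', hb', hbb⟩ := exists_covBy_le_of_lt (lt_of_le_of_ne (h ▸ inf_le_left) hb.symm)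
    obtain ⟨c', hc', hcc⟩ := exists_covBy_le_of_lt (lt_of_le_of_ne (h ▸ inf_le_right) hc.symm)
    obtain rfl : b' = c' := hs hb' hc'
    exact hb'.lt.not_ge (h ▸ le_inf hbb hcc)
  · intro h
    obtain ⟨v, hv, w, hw, hne⟩ := Set.not_subsingleton_iff.1 h
    exact ⟨v, w, hv.ne', hw.ne', inf_eq_of_covBy hv hw hne⟩

theorem isJoinReducible_iff [Finite L] {u : L} :
    IsJoinReducible u ↔ ¬ {w : L | w ⋖ u}.Subsingleton := by
  have h := isMeetReducible_iff (u := OrderDual.toDual u)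
  have h1 : IsMeetReducible (OrderDual.toDual u) ↔ IsJoinReducible u := Iff.rfl
  rw [← h1, h]
  have h2 : {w : Lᵒᵈ | OrderDual.toDual u ⋖ w} = OrderDual.ofDual ⁻¹' {w : L | w ⋖ u} := by
    ext w
    exact ofDual_covBy_ofDual_iff.symm
  rw [h2]
  rfl

theorem mem_redSet_iff [Finite L] {u : L} : u ∈ redSet L ↔ IsRed u := by
  simp only [redSet, Set.mem_ofPred_eq, isMeetReducible_iff, isJoinReducible_iff, IsRed, IsIrr]
  tauto

end Reducible

theorem IsBlowup.isBlockWith {L : Type*} [Lattice L] [Finite L] {f : L → B22}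
    (hf : IsBlowup f) : IsBlockWith L 4 3 := by
  classical
  have : Fintype L := Fintype.ofFinite L
  have hred : redSet L = {u | Even (f u).level} := Set.ext fun u => by
    rw [mem_redSet_iff, hf.isRed_iff, Set.mem_ofPred_eq]
  obtain ⟨b, hb⟩ := hf.exists_of_level (k := 0) (by norm_num)
  obtain ⟨t, ht⟩ := hf.exists_of_level le_rfl
  have hbot : IsBot b := fun v => hf.le_of_level_le (by omega) (by rw [hb]; decide)
  have htop : IsTop t := fun v => by
    rcases (B22.level_le_six (f v)).eq_or_lt with h | h
    · exact (hf.eq_of_level_eq (h.trans ht.symm) (by rw [h]; decide)).le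
    · exact (hf.lt_of_level_lt (by omega)).le
  have hcard : (redSet L).ncard = 4 := by
    have hinj : Set.InjOn f (redSet L) := fun u hu v _ h => hf.eq_of_even h (by rwa [hred] at hu)
    rw [← hinj.ncard_image]
    have : f '' redSet L = {t : B22 | Even t.level} := Set.ext fun t => by
      rw [hred]
      constructor
      · rintro ⟨u, hu, rfl⟩
        exact hu
      · intro h
        obtain ⟨u, rfl⟩ := hf.surj t
        exact ⟨u, h, rfl⟩
    rw [this, Set.ncard_eq_toFinset_card']
    decide
  have hsum : ∑ u : L, {w : L | u ⋖ w}.ncard = Fintype.card L + 2 := by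
    -- Irreducible elements have one upper cover, reducible ones two, except the top, which has
    -- none; its deficit is added on the left to avoid subtraction.
    have h : ∀ u : L, {w : L | u ⋖ w}.ncard + (if u = t then 2 else 0)
        = 1 + if u ∈ redSet L then 1 else 0 := fun u => by
      rw [hred, Set.mem_ofPred_eq]
      by_cases hut : u = t
      · subst hut
        have : {w : L | u ⋖ w} = ∅ := Set.eq_empty_of_forall_notMem fun w hw =>
          hw.lt.not_ge (htop w)
        rw [this, Set.ncard_empty, if_pos rfl, if_pos (by rw [ht]; decide)]
      · rw [if_neg hut]
        split_ifs with he
        · exact hf.ncard_covBy he fun h6 => hut (hf.eq_of_level_eq (h6.trans ht.symm) he)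
        · obtain ⟨w, hw, huniq⟩ := hf.existsUnique_covBy (Nat.not_even_iff_odd.1 he)
          rw [add_zero, add_zero, Set.ncard_eq_one]
          exact ⟨w, Set.ext fun v => ⟨fun hv => huniq v hv, by rintro rfl; exact hw⟩⟩
    have h' := Finset.sum_congr (rfl : (Finset.univ : Finset L) = _) fun u _ => h u
    rw [Finset.sum_add_distrib, Finset.sum_add_distrib, Finset.sum_ite_eq' Finset.univ t,
      if_pos (Finset.mem_univ t), Finset.sum_boole] at h'
    rw [Set.ncard_eq_toFinset_card'] at hcard
    have h2 : (Finset.univ.filter fun u => u ∈ redSet L) = (redSet L).toFinset := by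
      ext; simp
    rw [h2, hcard, Finset.sum_const, Finset.card_univ, smul_eq_mul, mul_one] at h'
    simp only [Nat.cast_ofNat] at h'
    omega
  refine ⟨⟨⟨b, hbot, isMeetReducible_iff.2 fun h => ?_⟩, t, htop, isJoinReducible_iff.2 fun h => ?_⟩,
    hcard, fun u hu v hv _ => ?_, ?_⟩
  · have := hf.ncard_covBy (u := b) (by rw [hb]; decide) (by rw [hb]; decide)
    have := Set.ncard_le_one_iff_subsingleton.2 h
    omega
  · have := hf.ncard_covBy' (u := t) (by rw [ht]; decide) (by rw [ht]; decide)
    have := Set.ncard_le_one_iff_subsingleton.2 h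
    omega
  · rw [hred] at hu hv
    rcases le_total (f u).level (f v).level with h | h
    · exact Or.inl (hf.le_of_level_le h hu)
    · exact Or.inr (hf.le_of_level_le h hv)
  · rw [nullity_eq hbot, hsum]
    push_cast
    ring

/-! ### Structure of basic retracts. -/

section Retracts

variable {P : Type*} [PartialOrder P]

theorem PendantStep.subset_of_reflTransGen {S T : Set P}
    (h : Relation.ReflTransGen PendantStep S T) : T ⊆ S := by
  induction h with
  | refl => exact subset_rfl
  | tail _ hstep ih =>
    obtain ⟨w, -, rfl⟩ := hstep
    exact Set.sdiff_subset.trans ih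

variable [Finite P]

/-- If the deleted `w` was the cover of `x`, the unique cover of `w` takes its place; otherwise the
least element above `x` is unchanged. -/
theorem existsUnique_covBy_sdiff {S : Set P} {w x : S} (hw : ∃! v, w ⋖ v) (hx : ∃! v, x ⋖ v)
    (x' : ↥(S \ {(w : P)})) (hx' : (x' : P) = x) : ∃! v, x' ⋖ v := by
  rw [existsUnique_covBy_iff] at hw hx ⊢
  obtain ⟨z, hwz, hz⟩ := hw
  obtain ⟨y, hxy, hy⟩ := hx
  by_cases h : y = w
  · subst h
    refine ⟨⟨z, z.2, fun h => hwz.ne' (Subtype.ext h)⟩, ?_, fun v hv => ?_⟩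
    · exact Subtype.coe_lt_coe.1 (hx' ▸ Subtype.coe_lt_coe.2 (hxy.trans hwz))
    · have hxv : x < ⟨v, v.2.1⟩ := Subtype.coe_lt_coe.1 (hx' ▸ Subtype.coe_lt_coe.2 hv)
      exact hz ⟨v, v.2.1⟩ (lt_of_le_of_ne (hy _ hxv) fun h => v.2.2 (congrArg Subtype.val h).symm)
  · refine ⟨⟨y, y.2, fun h' => h (Subtype.ext h')⟩, ?_, fun v hv => ?_⟩
    · exact Subtype.coe_lt_coe.1 (hx' ▸ Subtype.coe_lt_coe.2 hxy)
    · have hxv : x < ⟨v, v.2.1⟩ := Subtype.coe_lt_coe.1 (hx' ▸ Subtype.coe_lt_coe.2 hv)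
      exact hy ⟨v, v.2.1⟩ hxv

theorem existsUnique_covBy_sdiff' {S : Set P} {w x : S} (hw : ∃! v, v ⋖ w) (hx : ∃! v, v ⋖ x)
    (x' : ↥(S \ {(w : P)})) (hx' : (x' : P) = x) : ∃! v, v ⋖ x' := by
  rw [existsUnique_covBy_iff'] at hw hx ⊢
  obtain ⟨z, hwz, hz⟩ := hw
  obtain ⟨y, hxy, hy⟩ := hx
  by_cases h : y = w
  · subst h
    refine ⟨⟨z, z.2, fun h => hwz.ne (Subtype.ext h)⟩, ?_, fun v hv => ?_⟩
    · exact Subtype.coe_lt_coe.1 (hx' ▸ Subtype.coe_lt_coe.2 (hwz.trans hxy))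
    · have hxv : ⟨v, v.2.1⟩ < x := Subtype.coe_lt_coe.1 (hx' ▸ Subtype.coe_lt_coe.2 hv)
      exact hz ⟨v, v.2.1⟩ (lt_of_le_of_ne (hy _ hxv) fun h => v.2.2 (congrArg Subtype.val h))
  · refine ⟨⟨y, y.2, fun h' => h (Subtype.ext h')⟩, ?_, fun v hv => ?_⟩
    · exact Subtype.coe_lt_coe.1 (hx' ▸ Subtype.coe_lt_coe.2 hxy)
    · have hxv : ⟨v, v.2.1⟩ < x := Subtype.coe_lt_coe.1 (hx' ▸ Subtype.coe_lt_coe.2 hv)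
      exact hy ⟨v, v.2.1⟩ hxv

theorem isIrrStar_of_reflTransGen_retractStep {A S T : Set P}
    (h : Relation.ReflTransGen RetractStep S T)
    (hS : ∀ x : S, (x : P) ∉ A → IsIrrStar x) : ∀ x : T, (x : P) ∉ A → IsIrrStar x := by
  induction h with
  | refl => exact hS
  | tail _ hstep ih =>
    obtain ⟨w, hw, -, rfl⟩ := hstep
    intro x hx
    have hx' := ih ⟨x, x.2.1⟩ hx
    exact ⟨existsUnique_covBy_sdiff' hw.1 hx'.1 x rfl, existsUnique_covBy_sdiff hw.2 hx'.2 x rfl⟩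

/-- Both alternatives of retractibility fail, so a second path joins the reducible neighbours of
`x`. Its first step avoids `x`: through `x` it would be forced on to `z` and have to stop there.
That first step gives `w`. -/
theorem IsBasicRetract.exists_incomparable (hP : IsBasicRetract P) {x : P} (hx : IsIrrStar x) :
    ∃ y z w, IsRed y ∧ IsRed z ∧ y < x ∧ x < z ∧ (∀ v, v < x → v ≤ y) ∧ (∀ v, x < v → z ≤ v) ∧
      y < w ∧ w < z ∧ ¬ w ≤ x ∧ ¬ x ≤ w := by
  have hr := hP x hx
  obtain ⟨h1, h2⟩ := not_or.1 fun h => hr ⟨hx.isIrr, h⟩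
  obtain ⟨y, z, hy, hz, hyx, hxz⟩ := not_not.1 h1
  obtain ⟨l, ⟨hch, hhead, hlast⟩, hne⟩ : ∃ l, IsDirectedPath y z l ∧ l ≠ [y, x, z] := by
    by_contra hcon
    push Not at hcon
    exact h2 ⟨y, z, hy, hz, hyx, hxz, hcon⟩
  have hup : ∀ v, x < v → z ≤ v := fun v hv => by
    obtain ⟨c, hc, hcv⟩ := exists_covBy_le_of_lt hv
    rwa [hx.2.unique hxz hc]
  have hdown : ∀ v, v < x → v ≤ y := fun v hv => by
    obtain ⟨c, hc, hcv⟩ := existsUnique_covBy_iff'.1 hx.1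
    rcases (hcv y hyx.lt).eq_or_lt with h | h
    · exact h ▸ hcv v hv
    · exact absurd hc (hyx.2 h)
  obtain ⟨w, hyw, hwz, hwx⟩ : ∃ w, y ⋖ w ∧ w ≤ z ∧ w ≠ x := by
    match l, hch, hhead, hlast, hne with
    | [], _, hhead, _, _ => simp at hhead
    | [c], _, hhead, hlast, _ =>
      obtain rfl : c = y := by simpa using hhead
      obtain rfl : c = z := by simpa using hlast
      exact absurd (hyx.lt.trans hxz.lt) (lt_irrefl _)
    | c :: w :: l, hch, hhead, hlast, hne =>
      obtain rfl : c = y := by simpa using hhead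
      obtain ⟨hcw, hch⟩ := List.isChain_cons_cons.1 hch
      have hle : ∀ (l : List P) (w : P), (w :: l).IsChain (· ⋖ ·) →
          (w :: l).getLast? = some z → w ≤ z := by
        intro l
        induction l with
        | nil => intro w _ h; simp at h; exact h.le
        | cons d l ih =>
          intro w h h'
          obtain ⟨h1, h2⟩ := List.isChain_cons_cons.1 h
          exact h1.le.trans (ih d h2 (by simpa using h'))
      refine ⟨w, hcw, hle l w hch (by simpa using hlast), ?_⟩
      rintro rfl
      match l, hch, hlast, hne with
      | [], _, hlast, _ =>
        obtain rfl : w = z := by simpa using hlast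
        exact lt_irrefl _ hxz.lt
      | d :: l, hch, hlast, hne =>
        obtain ⟨hwd, hch⟩ := List.isChain_cons_cons.1 hch
        obtain rfl := hx.2.unique hxz hwd
        match l, hch, hlast, hne with
        | [], _, _, hne => exact hne rfl
        | e :: l, hch, hlast, _ =>
          obtain ⟨hde, hch⟩ := List.isChain_cons_cons.1 hch
          exact (hle l e hch (by simpa using hlast)).not_gt hde.lt
  obtain ⟨h3, h4⟩ := covBy_incomparable hyw hyx hwx
  refine ⟨y, z, w, hy, hz, hyx.lt, hxz.lt, hdown, hup, hyw.lt, lt_of_le_of_ne hwz ?_, h3, h4⟩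
  rintro rfl
  exact hyw.2 hyx.lt hxz.lt

end Retracts

theorem exists_strictMono_notMem_of_ncard_le {α : Type*} [PartialOrder α] [Finite α] {A : Set α}
    {n m : ℕ} (c : Fin n → α) (hc : StrictMono c) (hA : A.ncard + m ≤ n) :
    ∃ i : Fin m → Fin n, StrictMono i ∧ ∀ k, c (i k) ∉ A := by
  classical
  have h1 : (Finset.univ.filter fun i => c i ∈ A).card ≤ A.ncard := by
    rw [← Set.ncard_coe_finset, ← Set.InjOn.ncard_image (f := c) hc.injective.injOn]
    refine Set.ncard_le_ncard ?_ A.toFinite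
    rintro _ ⟨i, hi, rfl⟩
    simpa using hi
  have h2 := Finset.card_filter_add_card_filter_not (s := Finset.univ) fun i : Fin n => c i ∈ A
  rw [Finset.card_univ, Fintype.card_fin] at h2
  have h3 : m ≤ (Finset.univ.filter fun i => ¬ c i ∈ A).card := by omega
  refine ⟨Finset.orderEmbOfCardLe _ h3, OrderEmbedding.strictMono _, fun k => ?_⟩
  have := Finset.orderEmbOfCardLe_mem _ h3 k
  simpa using this

/-! ### Height six puts an incomparable pair in each gap. -/

section Height

variable {L : Type*} [Lattice L] [Finite L]

theorem existsUnique_covBy_of_notMem_redSet (ht : ∃ t : L, IsTop t ∧ t ∈ redSet L) {x : L}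
    (hx : x ∉ redSet L) : ∃! v, x ⋖ v := by
  obtain ⟨t, ht, htr⟩ := ht
  obtain ⟨v, hv, -⟩ := exists_covBy_le_of_lt
    (lt_of_le_of_ne (ht x) (by rintro rfl; exact hx htr))
  rw [mem_redSet_iff, IsRed, not_not] at hx
  exact ⟨v, hv, fun w hw => hx.2 hw hv⟩

theorem IsBlock.isIrrStar (hL : IsBlock L) {x : L} (hx : x ∉ redSet L) : IsIrrStar x := by
  obtain ⟨⟨b, hb, hbr⟩, ⟨t, ht, htr⟩⟩ := hL
  refine ⟨?_, existsUnique_covBy_of_notMem_redSet ⟨t, ht, Or.inr htr⟩ hx⟩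
  have h := existsUnique_covBy_of_notMem_redSet (L := Lᵒᵈ)
    ⟨OrderDual.toDual b, fun v => hb (OrderDual.ofDual v), Or.inr hbr⟩ (x := OrderDual.toDual x)
    (fun h => hx h.symm)
  simpa [ExistsUnique, OrderDual.exists, OrderDual.forall] using h

theorem IsBlock.exists_of_hasBasicBlockOfHeight (hL : IsBlock L) (hcard : (redSet L).ncard = 4)
    (h : HasBasicBlockOfHeight L 6) :
    ∃ r₀ r₁ r₂ r₃ : L, redSet L = {r₀, r₁, r₂, r₃} ∧ r₀ < r₁ ∧ r₁ < r₂ ∧ r₂ < r₃ ∧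
      (∃ x w, r₀ < x ∧ x < r₁ ∧ r₀ < w ∧ w < r₁ ∧ ¬ x ≤ w ∧ ¬ w ≤ x) ∧
      (∃ x w, r₁ < x ∧ x < r₂ ∧ r₁ < w ∧ w < r₂ ∧ ¬ x ≤ w ∧ ¬ w ≤ x) ∧
      (∃ x w, r₂ < x ∧ x < r₃ ∧ r₂ < w ∧ w < r₃ ∧ ¬ x ≤ w ∧ ¬ w ≤ x) := by
  obtain ⟨B, ⟨R, ⟨hR, hbr⟩, hRB, -⟩, hdim⟩ := h
  have hBR := PendantStep.subset_of_reflTransGen hRB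
  obtain ⟨p, hp⟩ := Order.le_krullDim_iff.1 hdim.ge
  have hirr : ∀ x : R, (x : L) ∉ redSet L → IsIrrStar x := by
    refine isIrrStar_of_reflTransGen_retractStep hR fun x hx => ?_
    obtain ⟨h1, h2⟩ := hL.isIrrStar hx
    rw [IsIrrStar, existsUnique_covBy_iff, existsUnique_covBy_iff']
    rw [existsUnique_covBy_iff] at h2
    rw [existsUnique_covBy_iff'] at h1
    obtain ⟨y, hy, hy'⟩ := h1
    obtain ⟨z, hz, hz'⟩ := h2
    exact ⟨⟨⟨y, trivial⟩, hy, fun v hv => hy' v hv⟩, ⟨⟨z, trivial⟩, hz, fun v hv => hz' v hv⟩⟩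
  have hred : ∀ y : R, IsRed y → (y : L) ∈ redSet L := fun y hy => by
    by_contra h
    exact hy (hirr y h).isIrr
  have hstr : StrictMono fun i => (p i : L) := fun i j hij => p.strictMono hij
  -- The chain has seven elements and at most four are reducible, which leaves three.
  obtain ⟨i, hi, hmem⟩ := exists_strictMono_notMem_of_ncard_le (A := redSet L) (m := 3) _ hstr
    (by omega)
  have key : ∀ k : Fin 3, ∃ y z w : R, IsRed y ∧ IsRed z ∧
      (y : L) < p (i k) ∧ (p (i k) : L) < z ∧
      (∀ v : R, (v : L) < p (i k) → v ≤ y) ∧ (∀ v : R, (p (i k) : L) < v → z ≤ v) ∧ y < w ∧ w < z ∧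
      ¬ (w : L) ≤ p (i k) ∧ ¬ (p (i k) : L) ≤ w := fun k =>
    hbr.exists_incomparable (hirr ⟨p (i k), hBR (p (i k)).2⟩ (hmem k))
  obtain ⟨y₀, z₀, w₀, hy₀, hz₀, hyx₀, hxz₀, -, hup₀, hyw₀, hwz₀, hwx₀, hxw₀⟩ := key 0
  obtain ⟨y₁, z₁, w₁, hy₁, hz₁, hyx₁, hxz₁, hdn₁, hup₁, hyw₁, hwz₁, hwx₁, hxw₁⟩ := key 1
  obtain ⟨y₂, z₂, w₂, hy₂, hz₂, hyx₂, hxz₂, hdn₂, -, hyw₂, hwz₂, hwx₂, hxw₂⟩ := key 2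
  have h01 : (p (i 0) : L) < p (i 1) := hstr (hi (by decide))
  have h12 : (p (i 1) : L) < p (i 2) := hstr (hi (by decide))
  -- `z` lies below `x'` and differs from it, being reducible, so it lies below the greatest element
  -- under `x'`.
  have step : ∀ (z y x x' : R), (∀ v : R, x < v → z ≤ v) → (∀ v : R, v < x' → v ≤ y) →
      (x' : L) ∉ redSet L → IsRed z → x < x' → z ≤ y := fun z y x x' hz hy hx' hzr hlt =>
    hy z (lt_of_le_of_ne (hz x' hlt) (by rintro rfl; exact hx' (hred _ hzr)))
  have hzy₀ : z₀ ≤ y₁ := step z₀ y₁ ⟨_, hBR (p (i 0)).2⟩ ⟨_, hBR (p (i 1)).2⟩ hup₀ hdn₁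
    (hmem 1) hz₀ h01
  have hzy₁ : z₁ ≤ y₂ := step z₁ y₂ ⟨_, hBR (p (i 1)).2⟩ ⟨_, hBR (p (i 2)).2⟩ hup₁ hdn₂
    (hmem 2) hz₁ h12
  rw [← Subtype.coe_le_coe] at hzy₀ hzy₁
  rw [← Subtype.coe_lt_coe] at hyw₀ hwz₀ hyw₁ hwz₁ hyw₂ hwz₂
  -- These four elements increase strictly, so they exhaust the reducible ones; then `y₁` and `y₂`
  -- have to be `z₀` and `z₁`.
  have hset : redSet L = {(y₀ : L), (z₀ : L), (z₁ : L), (z₂ : L)} := by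
    refine (Set.eq_of_subset_of_ncard_le ?_ ?_ (Set.toFinite _)).symm
    · rintro _ (rfl | rfl | rfl | rfl)
      exacts [hred _ hy₀, hred _ hz₀, hred _ hz₁, hred _ hz₂]
    · have e1 : (y₀ : L) ∉ ({(z₀ : L), (z₁ : L), (z₂ : L)} : Set L) := by
        simp only [Set.mem_insert_iff, Set.mem_singleton_iff]
        rintro (h | h | h) <;> order
      have e2 : (z₀ : L) ∉ ({(z₁ : L), (z₂ : L)} : Set L) := by
        simp only [Set.mem_insert_iff, Set.mem_singleton_iff]
        rintro (h | h) <;> order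
      have e3 : (z₁ : L) ≠ z₂ := fun h => by order
      rw [hcard, Set.ncard_insert_of_notMem e1, Set.ncard_insert_of_notMem e2, Set.ncard_pair e3]
  have hy₁' : (y₁ : L) = z₀ := by
    have := hred _ hy₁
    simp only [hset, Set.mem_insert_iff, Set.mem_singleton_iff] at this
    rcases this with h | h | h | h
    · order
    · exact h
    · order
    · order
  have hy₂' : (y₂ : L) = z₁ := by
    have := hred _ hy₂
    simp only [hset, Set.mem_insert_iff, Set.mem_singleton_iff] at this
    rcases this with h | h | h | h
    · order
    · order
    · exact h
    · order
  rw [hy₁'] at hyx₁ hyw₁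
  rw [hy₂'] at hyx₂ hyw₂
  exact ⟨y₀, z₀, z₁, z₂, hset, hyw₀.trans hwz₀, hyw₁.trans hwz₁, hyw₂.trans hwz₂,
    ⟨_, _, hyx₀, hxz₀, hyw₀, hwz₀, hxw₀, hwx₀⟩, ⟨_, _, hyx₁, hxz₁, hyw₁, hwz₁, hxw₁, hwx₁⟩,
    ⟨_, _, hyx₂, hxz₂, hyw₂, hwz₂, hxw₂, hwx₂⟩⟩

end Height

/-- The open interval between `r` and `r'` is the disjoint union of the two nonempty chains of
those elements that are above `p` and those that are not, elements of different chains being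
incomparable. -/
structure IsTwoChainSegment {P : Type*} [PartialOrder P] (r r' p : P) : Prop where
  left : r < p
  right : p < r'
  exists_not_le : ∃ q, r < q ∧ q < r' ∧ ¬ p ≤ q
  total : ∀ {u v}, r < u → u < r' → r < v → v < r' → (p ≤ u ↔ p ≤ v) → u ≤ v ∨ v ≤ u
  not_le : ∀ {u v}, r < u → u < r' → r < v → v < r' → p ≤ u → ¬ p ≤ v → ¬ v ≤ u

/-! ### Assembling a blowup from three segments. -/

section Segments

variable {P : Type*} [PartialOrder P]

/-- Since `r₁` and `r₂` are comparable with everything, each element is some `rᵢ` or lies inside one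
segment, where comparison with `pᵢ` selects its chain. -/
theorem exists_isBlowup_of_segments {r₀ r₁ r₂ r₃ p₀ p₁ p₂ : P} (hbot : IsBot r₀) (htop : IsTop r₃)
    (h₁ : ∀ u, u ≤ r₁ ∨ r₁ ≤ u) (h₂ : ∀ u, u ≤ r₂ ∨ r₂ ≤ u)
    (s₀ : IsTwoChainSegment r₀ r₁ p₀) (s₁ : IsTwoChainSegment r₁ r₂ p₁)
    (s₂ : IsTwoChainSegment r₂ r₃ p₂) : ∃ f : P → B22, IsBlowup f := by
  classical
  have h01 := s₀.left.trans s₀.right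
  have h12 := s₁.left.trans s₁.right
  have h23 := s₂.left.trans s₂.right
  let f : P → B22 := fun u =>
    if u = r₀ then .zero else if u < r₁ then (if p₀ ≤ u then .x else .c1)
    else if u = r₁ then .a else if u < r₂ then (if p₁ ≤ u then .y else .c2)
    else if u = r₂ then .b else if u < r₃ then (if p₂ ≤ u then .z else .c3) else .one
  have hf : ∀ u, f u = if u = r₀ then .zero else if u < r₁ then (if p₀ ≤ u then .x else .c1)
    else if u = r₁ then .a else if u < r₂ then (if p₁ ≤ u then .y else .c2)
    else if u = r₂ then .b else if u < r₃ then (if p₂ ≤ u then .z else .c3) else .one :=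
    fun _ => rfl
  have hcase : ∀ u, (u = r₀ ∧ f u = .zero) ∨ (r₀ < u ∧ u < r₁ ∧ p₀ ≤ u ∧ f u = .x) ∨
      (r₀ < u ∧ u < r₁ ∧ ¬ p₀ ≤ u ∧ f u = .c1) ∨ (u = r₁ ∧ f u = .a) ∨
      (r₁ < u ∧ u < r₂ ∧ p₁ ≤ u ∧ f u = .y) ∨ (r₁ < u ∧ u < r₂ ∧ ¬ p₁ ≤ u ∧ f u = .c2) ∨
      (u = r₂ ∧ f u = .b) ∨ (r₂ < u ∧ u < r₃ ∧ p₂ ≤ u ∧ f u = .z) ∨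
      (r₂ < u ∧ u < r₃ ∧ ¬ p₂ ≤ u ∧ f u = .c3) ∨ (u = r₃ ∧ f u = .one) := by
    intro u
    rw [hf]
    have hu := hbot u
    have hu' := htop u
    have hu₁ := h₁ u
    have hu₂ := h₂ u
    by_cases e0 : u = r₀
    · simp [e0]
    by_cases e1 : u < r₁
    · by_cases e : p₀ ≤ u <;> simp [e0, e1, e, lt_of_le_of_ne hu (Ne.symm e0)]
    by_cases e2 : u = r₁
    · simp [e2, h01.ne']
    have e1' : r₁ < u := lt_of_le_of_ne (hu₁.resolve_left fun h => e1 (lt_of_le_of_ne h e2))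
      (Ne.symm e2)
    by_cases e3 : u < r₂
    · by_cases e : p₁ ≤ u <;> simp [e0, e1, e2, e3, e, e1']
    by_cases e4 : u = r₂
    · simp [e4, h12.ne', (h01.trans h12).ne', h12.not_gt]
    have e3' : r₂ < u := lt_of_le_of_ne (hu₂.resolve_left fun h => e3 (lt_of_le_of_ne h e4))
      (Ne.symm e4)
    by_cases e5 : u < r₃
    · by_cases e : p₂ ≤ u <;> simp [e0, e1, e2, e3, e4, e5, e, e3']
    · have e6 : u = r₃ := by_contra fun h => e5 (lt_of_le_of_ne hu' h)
      subst e6; simp [e0, e1, e2, e3, e4]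
  have hlevel : ∀ {u v}, (f u).level < (f v).level → u < v := by
    intro u v h
    rcases hcase u with ⟨a₁, af⟩ | ⟨a₁, a₂, a₃, af⟩ | ⟨a₁, a₂, a₃, af⟩ | ⟨a₁, af⟩ | ⟨a₁, a₂, a₃, af⟩ |
      ⟨a₁, a₂, a₃, af⟩ | ⟨a₁, af⟩ | ⟨a₁, a₂, a₃, af⟩ | ⟨a₁, a₂, a₃, af⟩ | ⟨a₁, af⟩ <;>
    rcases hcase v with ⟨b₁, bf⟩ | ⟨b₁, b₂, b₃, bf⟩ | ⟨b₁, b₂, b₃, bf⟩ | ⟨b₁, bf⟩ | ⟨b₁, b₂, b₃, bf⟩ |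
      ⟨b₁, b₂, b₃, bf⟩ | ⟨b₁, bf⟩ | ⟨b₁, b₂, b₃, bf⟩ | ⟨b₁, b₂, b₃, bf⟩ | ⟨b₁, bf⟩ <;>
    rw [af, bf] at h <;>
    first
    | exact absurd h (by decide)
    | (clear h af bf; order)
  have hsame : ∀ {u v}, (f u).level = (f v).level →
      (f u = f v → u ≤ v ∨ v ≤ u) ∧ (f u ≠ f v → ¬ u ≤ v) ∧
        (f u = f v → Even (f u).level → u = v) := by
    intro u v h
    rcases hcase u with ⟨a₁, af⟩ | ⟨a₁, a₂, a₃, af⟩ | ⟨a₁, a₂, a₃, af⟩ | ⟨a₁, af⟩ | ⟨a₁, a₂, a₃, af⟩ |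
      ⟨a₁, a₂, a₃, af⟩ | ⟨a₁, af⟩ | ⟨a₁, a₂, a₃, af⟩ | ⟨a₁, a₂, a₃, af⟩ | ⟨a₁, af⟩ <;>
    rcases hcase v with ⟨b₁, bf⟩ | ⟨b₁, b₂, b₃, bf⟩ | ⟨b₁, b₂, b₃, bf⟩ | ⟨b₁, bf⟩ | ⟨b₁, b₂, b₃, bf⟩ |
      ⟨b₁, b₂, b₃, bf⟩ | ⟨b₁, bf⟩ | ⟨b₁, b₂, b₃, bf⟩ | ⟨b₁, b₂, b₃, bf⟩ | ⟨b₁, bf⟩ <;>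
    rw [af, bf] at h <;>
    first
    | exact absurd h (by decide)
    | (rw [af, bf]
       first
       | exact ⟨fun _ => Or.inl (a₁.trans b₁.symm).le, fun h => absurd rfl h,
          fun _ _ => a₁.trans b₁.symm⟩
       | exact ⟨fun _ => s₀.total a₁ a₂ b₁ b₂ (iff_of_true a₃ b₃), fun h => absurd rfl h,
          fun _ h => absurd h (by decide)⟩
       | exact ⟨fun _ => s₀.total a₁ a₂ b₁ b₂ (iff_of_false a₃ b₃), fun h => absurd rfl h,
          fun _ h => absurd h (by decide)⟩
       | exact ⟨fun h => absurd h (by decide), fun _ h => b₃ (a₃.trans h),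
          fun h => absurd h (by decide)⟩
       | exact ⟨fun h => absurd h (by decide), fun _ => s₀.not_le b₁ b₂ a₁ a₂ b₃ a₃,
          fun h => absurd h (by decide)⟩
       | exact ⟨fun _ => s₁.total a₁ a₂ b₁ b₂ (iff_of_true a₃ b₃), fun h => absurd rfl h,
          fun _ h => absurd h (by decide)⟩
       | exact ⟨fun _ => s₁.total a₁ a₂ b₁ b₂ (iff_of_false a₃ b₃), fun h => absurd rfl h,
          fun _ h => absurd h (by decide)⟩
       | exact ⟨fun h => absurd h (by decide), fun _ => s₁.not_le b₁ b₂ a₁ a₂ b₃ a₃,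
          fun h => absurd h (by decide)⟩
       | exact ⟨fun _ => s₂.total a₁ a₂ b₁ b₂ (iff_of_true a₃ b₃), fun h => absurd rfl h,
          fun _ h => absurd h (by decide)⟩
       | exact ⟨fun _ => s₂.total a₁ a₂ b₁ b₂ (iff_of_false a₃ b₃), fun h => absurd rfl h,
          fun _ h => absurd h (by decide)⟩
       | exact ⟨fun h => absurd h (by decide), fun _ => s₂.not_le b₁ b₂ a₁ a₂ b₃ a₃,
          fun h => absurd h (by decide)⟩)
  refine ⟨f, fun t => ?_, fun u v h => ?_, hlevel, fun {u v} h => (hsame (by rw [h])).1 h,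
    fun {u v} h => (hsame (by rw [h])).2.2 h⟩
  · obtain ⟨q₀, a₀, b₀, c₀⟩ := s₀.exists_not_le
    obtain ⟨q₁, a₁, b₁, c₁⟩ := s₁.exists_not_le
    obtain ⟨q₂, a₂, b₂, c₂⟩ := s₂.exists_not_le
    have l₀ := s₀.left
    have l₁ := s₁.left
    have l₂ := s₂.left
    have m₀ := s₀.right
    have m₁ := s₁.right
    have m₂ := s₂.right
    cases t
    · exact ⟨r₀, by simp [hf]⟩
    · exact ⟨p₀, by simp [hf, l₀.ne', m₀]⟩
    · exact ⟨q₀, by simp [hf, a₀.ne', b₀, c₀]⟩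
    · exact ⟨r₁, by simp [hf, h01.ne']⟩
    · refine ⟨p₁, ?_⟩
      rw [hf, if_neg (by order), if_neg (by order), if_neg (by order), if_pos m₁, if_pos le_rfl]
    · refine ⟨q₁, ?_⟩
      rw [hf, if_neg (by order), if_neg (by order), if_neg (by order), if_pos b₁, if_neg c₁]
    · refine ⟨r₂, ?_⟩
      rw [hf, if_neg (by order), if_neg (by order), if_neg (by order), if_neg (by order), if_pos rfl]
    · refine ⟨p₂, ?_⟩
      rw [hf, if_neg (by order), if_neg (by order), if_neg (by order), if_neg (by order),
        if_neg (by order), if_pos m₂, if_pos le_rfl]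
    · refine ⟨q₂, ?_⟩
      rw [hf, if_neg (by order), if_neg (by order), if_neg (by order), if_neg (by order),
        if_neg (by order), if_pos b₂, if_neg c₂]
    · refine ⟨r₃, ?_⟩
      rw [hf, if_neg (by order), if_neg (by order), if_neg (by order), if_neg (by order),
        if_neg (by order), if_neg (by order)]
  · rcases lt_trichotomy (f u).level (f v).level with hl | hl | hl
    · exact Or.inr hl
    · exact Or.inl (by_contra fun hne => (hsame hl).2.1 hne h)
    · exact absurd (hlevel hl) h.not_gt

end Segments

/-! ### Gaps between consecutive reducible elements of a lattice. -/

section LatticeSegments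

variable {L : Type*} [Lattice L]

theorem inf_mem_redSet {u v : L} (huv : ¬ u ≤ v) (hvu : ¬ v ≤ u) : u ⊓ v ∈ redSet L :=
  Or.inl ⟨u, v, fun h => huv (left_eq_inf.1 h), fun h => hvu (right_eq_inf.1 h), rfl⟩

theorem sup_mem_redSet {u v : L} (huv : ¬ u ≤ v) (hvu : ¬ v ≤ u) : u ⊔ v ∈ redSet L :=
  Or.inr ⟨u, v, fun h => hvu (left_eq_sup.1 h), fun h => huv (right_eq_sup.1 h), rfl⟩

variable {r r' : L}

/-- A cover of `r` below both `x` and `w` would put their reducible meet strictly inside the gap. -/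
theorem exists_covBy_ne_of_incomparable [Finite L] (hno : ∀ c ∈ redSet L, r < c → ¬ c < r')
    {x w : L} (hx : r < x) (hx' : x < r') (hw : r < w) (hxw : ¬ x ≤ w) (hwx : ¬ w ≤ x) :
    ∃ p q, r ⋖ p ∧ r ⋖ q ∧ p ≠ q ∧ p ≤ x ∧ q ≤ w := by
  obtain ⟨p, hp, hpx⟩ := exists_covBy_le_of_lt hx
  obtain ⟨q, hq, hqw⟩ := exists_covBy_le_of_lt hw
  refine ⟨p, q, hp, hq, ?_, hpx, hqw⟩
  rintro rfl
  exact hno _ (inf_mem_redSet hxw hwx) (hp.lt.trans_le (le_inf hpx hqw))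
    (inf_le_left.trans_lt hx')

/-- If `v` and `r'` were incomparable, a cover of `r` below `v` would also be below `r'`, so `v ⊓
r'` would be reducible inside the gap. -/
theorem le_or_le_of_covBy [Finite L] (hno : ∀ c ∈ redSet L, r < c → ¬ c < r') {p q : L}
    (hcov : ∀ c, r ⋖ c → c = p ∨ c = q) (hp : p < r') (hq : q < r') {v : L} (hv : r < v) :
    v ≤ r' ∨ r' ≤ v := by
  by_contra hcon
  obtain ⟨h1, h2⟩ := not_or.1 hcon
  obtain ⟨c, hc, hcv⟩ := exists_covBy_le_of_lt hv
  have hcr : c ≤ r' := by rcases hcov c hc with rfl | rfl <;> order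
  exact hno _ (inf_mem_redSet h1 h2) (hc.lt.trans_le (le_inf hcv hcr))
    (lt_of_le_of_ne inf_le_right fun h => h2 (inf_eq_right.1 h))

/-- Incomparable elements above the same cover would have a reducible meet in the gap; an element
above both covers would bound the reducible `p ⊔ q` inside it. -/
theorem isTwoChainSegment_of_covBy [Finite L] (hno : ∀ c ∈ redSet L, r < c → ¬ c < r') {p q : L}
    (hcov : ∀ c, r ⋖ c → c = p ∨ c = q) (hrp : r ⋖ p) (hrq : r ⋖ q) (hne : p ≠ q)
    (hp : p < r') (hq : q < r') : IsTwoChainSegment r r' p := by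
  have hor : ∀ v, r < v → p ≤ v ∨ q ≤ v := fun v hv => by
    obtain ⟨c, hc, hcv⟩ := exists_covBy_le_of_lt hv
    rcases hcov c hc with rfl | rfl
    exacts [Or.inl hcv, Or.inr hcv]
  obtain ⟨h1, h2⟩ := covBy_incomparable hrp hrq hne
  have key : ∀ {c u v}, r < c → c ≤ u → c ≤ v → u < r' → u ≤ v ∨ v ≤ u := by
    intro c u v hc hcu hcv hu
    by_contra hcon
    obtain ⟨h3, h4⟩ := not_or.1 hcon
    exact hno _ (inf_mem_redSet h3 h4) (hc.trans_le (le_inf hcu hcv)) (inf_le_left.trans_lt hu)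
  refine ⟨hrp.lt, hp, ⟨q, hrq.lt, hq, h1⟩, fun {u v} hu hu' hv hv' h => ?_,
    fun {u v} hu hu' hv hv' hpu hpv hvu => ?_⟩
  · by_cases hpu : p ≤ u
    · exact key hrp.lt hpu (h.1 hpu) hu'
    · exact key hrq.lt ((hor u hu).resolve_left hpu)
        ((hor v hv).resolve_left fun h' => hpu (h.2 h')) hu'
  · exact hno _ (sup_mem_redSet h1 h2) (hrp.lt.trans_le le_sup_left)
      ((sup_le hpu (((hor v hv).resolve_left hpv).trans hvu)).trans_lt hu')

/-- Nullity three means `|L| + 2` covering pairs. One per non-top element and one extra at each of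
three elements already reach this total, so every lower bound is attained. -/
theorem ncard_covBy_eq_two_of_nullity [Finite L] (hL : IsBlockWith L 4 3) {r₀ r₁ r₂ : L}
    (h01 : r₀ ≠ r₁) (h02 : r₀ ≠ r₂) (h12 : r₁ ≠ r₂)
    (hd : ∀ r, r = r₀ ∨ r = r₁ ∨ r = r₂ → 2 ≤ {w : L | r ⋖ w}.ncard) :
    ∀ r, r = r₀ ∨ r = r₁ ∨ r = r₂ → {w : L | r ⋖ w}.ncard = 2 := by
  classical
  have : Fintype L := Fintype.ofFinite L
  obtain ⟨⟨⟨b, hb, -⟩, ⟨t, ht, -⟩⟩, -, -, hnull⟩ := hL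
  rw [nullity_eq hb] at hnull
  have hsum : ∑ u : L, {w : L | u ⋖ w}.ncard = Fintype.card L + 2 := by
    push_cast at hnull
    zify
    linarith
  have hpos : ∀ u, u ≠ t → 1 ≤ {w : L | u ⋖ w}.ncard := fun u hu => by
    obtain ⟨w, hw, -⟩ := exists_covBy_le_of_lt (lt_of_le_of_ne (ht u) hu)
    exact (Set.ncard_pos (Set.toFinite _)).2 ⟨w, hw⟩
  have hle : ∀ u ∈ Finset.univ, 1 + (if u = r₀ then 1 else 0) + (if u = r₁ then 1 else 0) +
      (if u = r₂ then 1 else 0) ≤ {w : L | u ⋖ w}.ncard + if u = t then 1 else 0 := by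
    intro u _
    have hd := hd u
    have hpos := hpos u
    by_cases e0 : u = r₀
    · have e1 : u ≠ r₁ := fun h => h01 (e0.symm.trans h)
      have e2 : u ≠ r₂ := fun h => h02 (e0.symm.trans h)
      have := hd (Or.inl e0)
      rw [if_pos e0, if_neg e1, if_neg e2]
      omega
    · rw [if_neg e0]
      by_cases e1 : u = r₁
      · have e2 : u ≠ r₂ := fun h => h12 (e1.symm.trans h)
        have := hd (Or.inr (Or.inl e1))
        rw [if_pos e1, if_neg e2]
        omega
      · rw [if_neg e1]
        by_cases e2 : u = r₂
        · have := hd (Or.inr (Or.inr e2))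
          rw [if_pos e2]
          omega
        · rw [if_neg e2]
          by_cases e3 : u = t
          · rw [if_pos e3]
            omega
          · have := hpos e3
            omega
  have heq := (Finset.sum_eq_sum_iff_of_le hle).1 (by
    simp only [Finset.sum_add_distrib, Finset.sum_ite_eq', Finset.mem_univ, if_true, hsum,
      Finset.sum_const, Finset.card_univ, smul_eq_mul, mul_one])
  intro r hr
  have h2 := hd r hr
  have hrt : r ≠ t := by
    rintro rfl
    have h0 : {w : L | r ⋖ w} = ∅ := Set.eq_empty_of_forall_notMem fun w hw =>
      hw.lt.not_ge (ht w)
    rw [h0, Set.ncard_empty] at h2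
    omega
  have h3 := heq r (Finset.mem_univ r)
  rw [if_neg hrt] at h3
  rcases hr with rfl | rfl | rfl
  · rw [if_pos rfl, if_neg h01, if_neg h02] at h3
    omega
  · rw [if_neg h01.symm, if_pos rfl, if_neg h12] at h3
    omega
  · rw [if_neg h02.symm, if_neg h12.symm, if_pos rfl] at h3
    omega

theorem exists_isBlowup [Finite L] (hL : IsBlockWith L 4 3) (h6 : HasBasicBlockOfHeight L 6) :
    ∃ f : L → B22, IsBlowup f := by
  obtain ⟨r₀, r₁, r₂, r₃, hred, h01, h12, h23, ⟨x₀, w₀, a₀, b₀, c₀, d₀, e₀, f₀⟩,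
    ⟨x₁, w₁, a₁, b₁, c₁, d₁, e₁, f₁⟩, ⟨x₂, w₂, a₂, b₂, c₂, d₂, e₂, f₂⟩⟩ :=
    hL.1.exists_of_hasBasicBlockOfHeight hL.2.1 h6
  have hmem : ∀ c ∈ redSet L, c = r₀ ∨ c = r₁ ∨ c = r₂ ∨ c = r₃ := fun c hc => by
    rw [hred] at hc
    simpa using hc
  have no₀ : ∀ c ∈ redSet L, r₀ < c → ¬ c < r₁ := fun c hc h h' => by
    rcases hmem c hc with rfl | rfl | rfl | rfl <;> order
  have no₁ : ∀ c ∈ redSet L, r₁ < c → ¬ c < r₂ := fun c hc h h' => by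
    rcases hmem c hc with rfl | rfl | rfl | rfl <;> order
  have no₂ : ∀ c ∈ redSet L, r₂ < c → ¬ c < r₃ := fun c hc h h' => by
    rcases hmem c hc with rfl | rfl | rfl | rfl <;> order
  obtain ⟨p₀, q₀, hp₀, hq₀, hne₀, hpx₀, hqw₀⟩ :=
    exists_covBy_ne_of_incomparable no₀ a₀ b₀ c₀ e₀ f₀
  obtain ⟨p₁, q₁, hp₁, hq₁, hne₁, hpx₁, hqw₁⟩ :=
    exists_covBy_ne_of_incomparable no₁ a₁ b₁ c₁ e₁ f₁
  obtain ⟨p₂, q₂, hp₂, hq₂, hne₂, hpx₂, hqw₂⟩ :=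
    exists_covBy_ne_of_incomparable no₂ a₂ b₂ c₂ e₂ f₂
  have hpair : ∀ {r p q : L}, r ⋖ p → r ⋖ q → p ≠ q → ({p, q} : Set L) ⊆ {w | r ⋖ w} ∧
      ({p, q} : Set L).ncard = 2 := fun hp hq hne => by
    refine ⟨?_, Set.ncard_pair hne⟩
    rintro _ (rfl | rfl)
    exacts [hp, hq]
  have htwo := ncard_covBy_eq_two_of_nullity hL h01.ne (h01.trans h12).ne h12.ne (by
    rintro r (rfl | rfl | rfl)
    · exact (hpair hp₀ hq₀ hne₀).2 ▸ Set.ncard_le_ncard (hpair hp₀ hq₀ hne₀).1 (Set.toFinite _)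
    · exact (hpair hp₁ hq₁ hne₁).2 ▸ Set.ncard_le_ncard (hpair hp₁ hq₁ hne₁).1 (Set.toFinite _)
    · exact (hpair hp₂ hq₂ hne₂).2 ▸ Set.ncard_le_ncard (hpair hp₂ hq₂ hne₂).1 (Set.toFinite _))
  have hcov : ∀ {r p q : L}, r ⋖ p → r ⋖ q → p ≠ q → {w : L | r ⋖ w}.ncard = 2 →
      ∀ c, r ⋖ c → c = p ∨ c = q := fun hp hq hne h2 c hc => by
    obtain ⟨hsub, hcard⟩ := hpair hp hq hne
    have := Set.eq_of_subset_of_ncard_le hsub (by rw [h2, hcard]) (Set.toFinite _)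
    simpa using this.ge hc
  have cov₀ := hcov hp₀ hq₀ hne₀ (htwo _ (Or.inl rfl))
  have cov₁ := hcov hp₁ hq₁ hne₁ (htwo _ (Or.inr (Or.inl rfl)))
  have cov₂ := hcov hp₂ hq₂ hne₂ (htwo _ (Or.inr (Or.inr rfl)))
  obtain ⟨⟨b, hb, hbr⟩, ⟨t, ht, htr⟩⟩ := hL.1
  have hbot : IsBot r₀ := by
    have hbr₀ : b = r₀ := by
      have := hb r₀
      rcases hmem b (Or.inl hbr) with rfl | rfl | rfl | rfl <;> order
    exact hbr₀ ▸ hb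
  have htop : IsTop r₃ := by
    have htr₃ : t = r₃ := by
      have := ht r₃
      rcases hmem t (Or.inr htr) with rfl | rfl | rfl | rfl <;> order
    exact htr₃ ▸ ht
  have cmp₁ : ∀ u, u ≤ r₁ ∨ r₁ ≤ u := fun u => by
    rcases (hbot u).eq_or_lt with rfl | hu
    · exact Or.inl h01.le
    · exact le_or_le_of_covBy no₀ cov₀ (hpx₀.trans_lt b₀) (hqw₀.trans_lt d₀) hu
  have cmp₂ : ∀ u, u ≤ r₂ ∨ r₂ ≤ u := fun u => by
    rcases cmp₁ u with hu | hu
    · exact Or.inl (hu.trans h12.le)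
    · rcases hu.eq_or_lt with rfl | hu
      · exact Or.inl h12.le
      · exact le_or_le_of_covBy no₁ cov₁ (hpx₁.trans_lt b₁) (hqw₁.trans_lt d₁) hu
  exact exists_isBlowup_of_segments hbot htop cmp₁ cmp₂
    (isTwoChainSegment_of_covBy no₀ cov₀ hp₀ hq₀ hne₀ (hpx₀.trans_lt b₀) (hqw₀.trans_lt d₀))
    (isTwoChainSegment_of_covBy no₁ cov₁ hp₁ hq₁ hne₁ (hpx₁.trans_lt b₁) (hqw₁.trans_lt d₁))
    (isTwoChainSegment_of_covBy no₂ cov₂ hp₂ hq₂ hne₂ (hpx₂.trans_lt b₂) (hqw₂.trans_lt d₂))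

end LatticeSegments

/-! ### Both classes are the blowups of `B22`. -/

theorem blocksOfHeight_eq (j : ℕ) :
    blocksOfHeight j 4 3 6 = {L | ∃ f : Fin j → B22, @IsBlowup (Fin j) L.toPartialOrder f} :=
  Set.ext fun L => ⟨fun h => @exists_isBlowup (Fin j) L _ h.1 h.2, fun ⟨f, hf⟩ =>
    ⟨@IsBlowup.isBlockWith (Fin j) L _ f hf,
      @HasBasicBlock.hasBasicBlockOfHeight (Fin j) L (@IsBlowup.hasBasicBlock (Fin j) L _ f hf)⟩⟩

theorem blocksB22_eq (j : ℕ) :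
    blocksB22 j = {L | ∃ f : Fin j → B22, @IsBlowup (Fin j) L.toPartialOrder f} :=
  Set.ext fun L => ⟨fun h => @exists_isBlowup (Fin j) L _ h.1
      (@HasBasicBlock.hasBasicBlockOfHeight (Fin j) L h.2), fun ⟨f, hf⟩ =>
    ⟨@IsBlowup.isBlockWith (Fin j) L _ f hf, @IsBlowup.hasBasicBlock (Fin j) L _ f hf⟩⟩

/-! ### Blowups up to isomorphism. -/

namespace IsBlowup

variable {P : Type*} [PartialOrder P] {f : P → B22}

/-- For an incomparable pair the meet is the unique element of the even level just below. -/
theorem exists_greatest_lower_bound (hf : IsBlowup f) (u v : P) :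
    ∃ w, w ≤ u ∧ w ≤ v ∧ ∀ c, c ≤ u → c ≤ v → c ≤ w := by
  by_cases huv : u ≤ v
  · exact ⟨u, le_rfl, huv, fun c h _ => h⟩
  by_cases hvu : v ≤ u
  · exact ⟨v, hvu, le_rfl, fun c _ h => h⟩
  obtain ⟨hl, hne, ho⟩ := hf.incomparable huv hvu
  have := B22.level_le_six (f u)
  rw [Nat.odd_iff] at ho
  obtain ⟨e, he⟩ := hf.exists_of_level (k := (f u).level - 1) (by omega)
  refine ⟨e, (hf.lt_of_level_lt (by omega)).le, (hf.lt_of_level_lt (by omega)).le,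
    fun c hcu hcv => ?_⟩
  have hlc : (f c).level ≤ (f e).level := by
    rcases hf.mono hcu with h | h
    · rcases hf.mono hcv with h' | h'
      · exact absurd (h.symm.trans h') hne
      · rw [h] at h'
        omega
    · omega
  rcases hlc.eq_or_lt with h | h
  · exact (hf.eq_of_level_eq h (by rw [h, he, Nat.even_iff]; omega)).le
  · exact (hf.lt_of_level_lt h).le

theorem exists_least_upper_bound (hf : IsBlowup f) (u v : P) :
    ∃ w, u ≤ w ∧ v ≤ w ∧ ∀ c, u ≤ c → v ≤ c → w ≤ c :=
  hf.dual.exists_greatest_lower_bound (OrderDual.toDual u) (OrderDual.toDual v)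

theorem exists_lattice {P : Type*} [i : PartialOrder P] {f : P → B22} (hf : IsBlowup f) :
    ∃ L : Lattice P, L.toPartialOrder = i := by
  choose m h1 h2 h3 using hf.exists_greatest_lower_bound
  choose s h4 h5 h6 using hf.exists_least_upper_bound
  exact ⟨{ i with
    inf := m
    sup := s
    inf_le_left := h1
    inf_le_right := h2
    le_inf := fun a b c hab hac => h3 b c a hab hac
    le_sup_left := h4
    le_sup_right := h5
    sup_le := fun a b c hac hbc => h6 a b c hac hbc }, rfl⟩

theorem le_iff (hf : IsBlowup f) {u v : P} :
    u ≤ v ↔ (f u).level < (f v).level ∨ (f u = f v ∧ u ≤ v) :=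
  ⟨fun h => (hf.mono h).elim (fun h' => Or.inr ⟨h', h⟩) Or.inl,
    fun h => h.elim (fun h' => (hf.lt_of_level_lt h').le) And.right⟩

theorem nonempty_fiber_orderIso [Finite P] (hf : IsBlowup f) (t : B22) :
    Nonempty (Fin (Nat.card {u // f u = t}) ≃o {u // f u = t}) := by
  classical
  let _ : LinearOrder {u // f u = t} :=
    { (inferInstance : PartialOrder {u // f u = t}) with
      le_total := fun u v => hf.total (u.2.trans v.2.symm)
      toDecidableLE := Classical.decRel _ }
  have : Fintype {u // f u = t} := Fintype.ofFinite _
  exact ⟨Fintype.orderIsoFinOfCardEq _ Nat.card_eq_fintype_card.symm⟩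

/-- Order between fibres depends only on levels, so isomorphisms of the finite chains glue fibre by
fibre. -/
theorem nonempty_orderIso_of_card_eq {Q : Type*} [PartialOrder Q] [Finite P] [Finite Q]
    {g : Q → B22} (hf : IsBlowup f) (hg : IsBlowup g)
    (h : ∀ t, Nat.card {u // f u = t} = Nat.card {u // g u = t}) : Nonempty (P ≃o Q) := by
  have e : ∀ t, Nonempty ({u // f u = t} ≃o {u // g u = t}) := fun t => by
    obtain ⟨a⟩ := hf.nonempty_fiber_orderIso t
    obtain ⟨b⟩ := hg.nonempty_fiber_orderIso t
    exact ⟨a.symm.trans ((Fin.castOrderIso (h t)).trans b)⟩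
  let e' := fun t => (e t).some
  let E : P ≃ Q := (Equiv.sigmaFiberEquiv f).symm.trans
    ((Equiv.sigmaCongrRight fun t => (e' t).toEquiv).trans (Equiv.sigmaFiberEquiv g))
  have hE : ∀ {u t} (hu : f u = t), E u = (e' t ⟨u, hu⟩ : Q) := by
    rintro u _ rfl
    rfl
  have hgE : ∀ u, g (E u) = f u := fun u => by
    rw [hE rfl]
    exact (e' (f u) ⟨u, rfl⟩).2
  refine ⟨⟨E, fun {u v} => ?_⟩⟩
  rw [hg.le_iff, hf.le_iff, hgE, hgE]
  refine or_congr_right (and_congr_right fun huv => ?_)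
  rw [hE huv, hE rfl]
  exact (e' (f v)).le_iff_le (x := ⟨u, huv⟩) (y := ⟨v, rfl⟩)

theorem comp (hf : IsBlowup f) {σ : B22 → B22} (hσ : Function.Involutive σ)
    (hl : ∀ t, (σ t).level = t.level) : IsBlowup fun u => σ (f u) where
  surj := hσ.surjective.comp hf.surj
  mono u v h := by
    rcases hf.mono h with h | h
    · exact Or.inl (congrArg σ h)
    · exact Or.inr (by rwa [hl, hl])
  lt_of_level_lt h := hf.lt_of_level_lt (by rwa [hl, hl] at h)
  total h := hf.total (hσ.injective h)
  eq_of_even h he := hf.eq_of_even (hσ.injective h) (by rwa [hl] at he)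

/-- Even level means reducible, whichever map is used. Climbing from a reducible element raises the
`g`-level by at least one, and by at least two when the target is reducible as well. -/
theorem level_le_level [Finite P] {g : P → B22} (hf : IsBlowup f) (hg : IsBlowup g) (u : P) :
    (f u).level ≤ (g u).level := by
  induction hk : (f u).level using Nat.strong_induction_on generalizing u with
  | _ k ih =>
    have h6 := B22.level_le_six (f u)
    rcases k with _ | k
    · exact Nat.zero_le _
    by_cases hk2 : Even k
    · obtain ⟨e, he⟩ := hf.exists_of_level (k := k) (by omega)
      have h1 := ih k (by omega) e he
      have heu : e < u := hf.lt_of_level_lt (by omega)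
      have := hg.level_lt heu (hg.isRed_iff.1 (hf.isRed_of_even (by rwa [he])))
      omega
    · rw [Nat.even_iff] at hk2
      obtain ⟨e, he⟩ := hf.exists_of_level (k := k - 1) (by omega)
      have h1 := ih (k - 1) (by omega) e he
      have heu : e < u := hf.lt_of_level_lt (by omega)
      have h2 := hg.isRed_iff.1 (hf.isRed_of_even (u := e) (by rw [he, Nat.even_iff]; omega))
      have h3 := hg.level_lt heu h2
      have h4 := hg.isRed_iff.1 (hf.isRed_of_even (u := u) (by rw [hk, Nat.even_iff]; omega))
      rw [Nat.even_iff] at h2 h4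
      omega

theorem level_eq_level [Finite P] {g : P → B22} (hf : IsBlowup f) (hg : IsBlowup g) (u : P) :
    (f u).level = (g u).level :=
  (hf.level_le_level hg u).antisymm (hg.level_le_level hf u)

theorem eq_iff (hf : IsBlowup f) {u v : P} :
    f u = f v ↔ (f u).level = (f v).level ∧ (u ≤ v ∨ v ≤ u) :=
  ⟨fun h => ⟨by rw [h], hf.total h⟩, fun ⟨h, h'⟩ => by
    by_contra hne
    exact h'.elim (hf.not_le_of_ne h hne) (hf.not_le_of_ne h.symm (Ne.symm hne))⟩

theorem eq_iff_eq [Finite P] {g : P → B22} (hf : IsBlowup f) (hg : IsBlowup g) {u v : P} :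
    f u = f v ↔ g u = g v := by
  rw [hf.eq_iff, hg.eq_iff, hf.level_eq_level hg, hf.level_eq_level hg]

theorem card_fiber_eq_or [Finite P] {g : P → B22} (hf : IsBlowup f) (hg : IsBlowup g) (t : B22) :
    (Nat.card {u // f u = t} = Nat.card {u // g u = t} ∧
        Nat.card {u // f u = t.sibling} = Nat.card {u // g u = t.sibling}) ∨
      (Nat.card {u // f u = t} = Nat.card {u // g u = t.sibling} ∧
        Nat.card {u // f u = t.sibling} = Nat.card {u // g u = t}) := by
  have key : ∀ u, Nat.card {v // f v = f u} = Nat.card {v // g v = g u} := fun u =>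
    Nat.card_congr (Equiv.subtypeEquivRight fun v => hf.eq_iff_eq hg)
  obtain ⟨u, rfl⟩ := hf.surj t
  obtain ⟨v, hv⟩ := hf.surj (f u).sibling
  have hu' := B22.eq_or_eq_sibling (hf.level_eq_level hg u).symm
  have hv' := B22.eq_or_eq_sibling (s := g v) (t := f u)
    (by rw [← hf.level_eq_level hg, hv, B22.level_sibling])
  have hku := key u
  have hkv := key v
  rw [hv] at hkv
  rcases hu' with hu' | hu' <;> rcases hv' with hv' | hv' <;> rw [hu'] at hku <;> rw [hv'] at hkv
  -- Both representatives share a fibre of `g`, hence of `f`: the level has a single fibre, which is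
  -- its own sibling.
  · have h := (hf.eq_iff_eq hg).2 (hu'.trans hv'.symm)
    rw [hv] at h
    rw [← h] at hkv ⊢
    exact Or.inl ⟨hku, hkv⟩
  · exact Or.inl ⟨hku, hkv⟩
  · exact Or.inr ⟨hku, hkv⟩
  · have h := (hf.eq_iff_eq hg).2 (hu'.trans hv'.symm)
    rw [hv] at h
    rw [← h] at hkv ⊢
    rw [← h] at hku
    exact Or.inl ⟨hku, hkv⟩

theorem card_fiber_pos [Finite P] (hf : IsBlowup f) (t : B22) : 0 < Nat.card {u // f u = t} := by
  obtain ⟨u, hu⟩ := hf.surj t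
  have : Nonempty {u // f u = t} := ⟨⟨u, hu⟩⟩
  exact Nat.card_pos

theorem card_fiber_eq_one (hf : IsBlowup f) {t : B22} (ht : Even t.level) :
    Nat.card {u // f u = t} = 1 := by
  obtain ⟨u, rfl⟩ := hf.surj t
  rw [Nat.card_eq_one_iff_unique]
  exact ⟨⟨fun a b => Subtype.ext (hf.eq_of_even (a.2.trans b.2.symm) (by rw [a.2]; exact ht))⟩,
    ⟨⟨u, rfl⟩⟩⟩

end IsBlowup

/-! ### Fibre sizes as a complete invariant. -/

theorem isBlowup_of_le_iff {P : Type*} [PartialOrder P] {α : Type*} [LinearOrder α] {f : P → B22}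
    {r : P → α} (hle : ∀ u v, u ≤ v ↔ f u < f v ∨ f u = f v ∧ r u ≤ r v)
    (hs : Function.Surjective f) (he : ∀ {u v}, f u = f v → Even (f u).level → u = v) :
    IsBlowup f where
  surj := hs
  mono u v h := ((hle u v).1 h).elim le_of_lt fun h' => h'.1.le
  lt_of_level_lt {u v} h := by
    rw [← B22.lt_iff] at h
    refine lt_of_le_not_ge ((hle u v).2 (Or.inl h)) fun h' => ?_
    rcases (hle v u).1 h' with h' | h'
    · exact h.asymm h'
    · exact h.ne h'.1.symm
  total {u v} h := by
    rw [hle, hle]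
    exact (le_total (r u) (r v)).imp (fun h' => Or.inr ⟨h, h'⟩) fun h' => Or.inr ⟨h.symm, h'⟩
  eq_of_even := he

/-- The sequences of fibre sizes of the maps `f : P → B₂₂` presenting posets `P` on `j` elements,
where the two chains between consecutive reducible elements are listed by increasing size. -/
def fiberSizes (j : ℕ) : Set (B22 → ℕ) :=
  {n | (∀ t, 0 < n t) ∧ (∀ t, Even t.level → n t = 1) ∧ ∑ t, n t = j ∧
    n .x ≤ n .c1 ∧ n .y ≤ n .c2 ∧ n .z ≤ n .c3}

theorem sum_card_fiber {P : Type*} [Finite P] (f : P → B22) :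
    ∑ t, Nat.card {u // f u = t} = Nat.card P := by
  rw [← Nat.card_sigma, Nat.card_congr (Equiv.sigmaFiberEquiv f)]

theorem exists_lattice_of_fiberSizes {j : ℕ} {n : B22 → ℕ} (hn : n ∈ fiberSizes j) :
    ∃ L : Lattice (Fin j), ∃ f : Fin j → B22, @IsBlowup (Fin j) L.toPartialOrder f ∧
      ∀ t, Nat.card {u // f u = t} = n t := by
  obtain ⟨hpos, heven, hsum, -⟩ := hn
  have hcard : Fintype.card (Σ t, Fin (n t)) = Fintype.card (Fin j) := by
    simpa using hsum
  obtain ⟨e⟩ := Fintype.card_eq.1 hcard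
  let f : Fin j → B22 := fun u => (e.symm u).1
  have hfib : ∀ t, Nat.card {u // f u = t} = n t := fun t => by
    have hb : Function.Bijective fun k : Fin (n t) =>
        (⟨e ⟨t, k⟩, by simp [f]⟩ : {u // f u = t}) := by
      refine ⟨fun k l h => ?_, fun ⟨u, hu⟩ => ?_⟩
      · simpa using h
      · obtain ⟨⟨t', k⟩, rfl⟩ := e.surjective u
        obtain rfl : t' = t := by simpa [f] using hu
        exact ⟨k, rfl⟩
    rw [← Nat.card_congr (Equiv.ofBijective _ hb), Nat.card_fin]
  -- The order compares images in `B22` first; the numerical order of `Fin j` then makes each fibre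
  -- a chain.
  let i : PartialOrder (Fin j) := PartialOrder.lift (fun u => toLex (f u, u)) fun u v h =>
    congrArg Prod.snd (toLex.injective h)
  have hle : ∀ u v : Fin j, i.le u v ↔ f u < f v ∨ f u = f v ∧ u.val ≤ v.val := fun u v =>
    Prod.Lex.toLex_le_toLex
  have hf : @IsBlowup (Fin j) i f := by
    refine @isBlowup_of_le_iff (Fin j) i _ _ f Fin.val hle (fun t => ?_) fun {u v} h he => ?_
    · have : 0 < Nat.card {u // f u = t} := by
        rw [hfib]
        exact hpos t
      obtain ⟨⟨u, hu⟩⟩ := (Nat.card_pos_iff.1 this).1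
      exact ⟨u, hu⟩
    · have h1 := hfib (f v)
      rw [heven _ (h ▸ he), Nat.card_eq_one_iff_unique] at h1
      exact congrArg Subtype.val (h1.1.elim ⟨u, h⟩ ⟨v, rfl⟩)
  obtain ⟨L, hL⟩ := @IsBlowup.exists_lattice (Fin j) i f hf
  exact ⟨L, f, by rw [hL]; exact hf, hfib⟩

theorem B22.sum_univ (n : B22 → ℕ) : ∑ t, n t = n .zero + n .x + n .c1 + n .a + n .y + n .c2 +
    n .b + n .z + n .c3 + n .one := by
  have : (Finset.univ : Finset B22) = {.zero, .x, .c1, .a, .y, .c2, .b, .z, .c3, .one} := rfl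
  rw [this]
  repeat rw [Finset.sum_insert (by decide)]
  rw [Finset.sum_singleton]
  ring

theorem IsBlowup.exists_fiberSizes {P : Type*} [PartialOrder P] [Finite P] {f : P → B22}
    (hf : IsBlowup f) : ∃ n ∈ fiberSizes (Nat.card P), ∃ g : P → B22, IsBlowup g ∧
      ∀ t, Nat.card {u // g u = t} = n t := by
  classical
  let n : B22 → ℕ := fun t => Nat.card {u // f u = t}
  -- Siblings are swapped exactly at the levels whose two sizes are out of order; the test depends
  -- only on the level, so `σ` is an involution.
  let σ : B22 → B22 := fun t =>
    if (t.level = 1 ∧ n .c1 < n .x) ∨ (t.level = 3 ∧ n .c2 < n .y) ∨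
      (t.level = 5 ∧ n .c3 < n .z) then t.sibling else t
  have hl : ∀ t, (σ t).level = t.level := fun t => by
    simp only [σ]
    split_ifs
    exacts [B22.level_sibling t, rfl]
  have hσ : Function.Involutive σ := fun t => by
    have h : σ (σ t) = if (t.level = 1 ∧ n .c1 < n .x) ∨ (t.level = 3 ∧ n .c2 < n .y) ∨
      (t.level = 5 ∧ n .c3 < n .z) then (σ t).sibling else σ t := by
      rw [← hl t]
    rw [h]
    simp only [σ]
    split_ifs
    · cases t <;> rfl
    · rfl
  have hg := hf.comp hσ hl
  have hcard : ∀ t, Nat.card {u // σ (f u) = t} = n (σ t) := fun t =>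
    Nat.card_congr (Equiv.subtypeEquivRight fun u => hσ.eq_iff)
  refine ⟨fun t => n (σ t), ⟨fun t => ?_, fun t ht => ?_, ?_, ?_, ?_, ?_⟩, _, hg, hcard⟩
  · exact (hg.card_fiber_pos t).trans_eq (hcard t)
  · exact (hcard t).symm.trans (hg.card_fiber_eq_one ht)
  · simp only [← hcard]
    exact sum_card_fiber _
  all_goals
    simp only [σ, B22.level, B22.sibling]
    norm_num only [true_and, false_and, false_or, or_false]
    split_ifs <;> omega

/-- Sizes agree up to swapping siblings, and sorting each pair removes that ambiguity. -/
theorem IsBlowup.fiberSizes_unique {P : Type*} [PartialOrder P] [Finite P] {f g : P → B22}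
    (hf : IsBlowup f) (hg : IsBlowup g) {j : ℕ} {n m : B22 → ℕ} (hn : n ∈ fiberSizes j)
    (hm : m ∈ fiberSizes j) (hfn : ∀ t, Nat.card {u // f u = t} = n t)
    (hgm : ∀ t, Nat.card {u // g u = t} = m t) : n = m := by
  have key := hf.card_fiber_eq_or hg
  simp only [hfn, hgm] at key
  obtain ⟨-, he, -, h1, h2, h3⟩ := hn
  obtain ⟨-, he', -, h1', h2', h3'⟩ := hm
  have kx := key .x
  have ky := key .y
  have kz := key .z
  simp only [B22.sibling] at kx ky kz
  funext t
  cases t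
  case zero | a | b | one => rw [he _ (by decide), he' _ (by decide)]
  all_goals omega

theorem IsBlowup.of_orderIso {P Q : Type*} [PartialOrder P] [PartialOrder Q] {g : Q → B22}
    (hg : IsBlowup g) (e : P ≃o Q) : IsBlowup fun u => g (e u) where
  surj := hg.surj.comp e.surjective
  mono _ _ h := hg.mono (e.monotone h)
  lt_of_level_lt h := e.lt_iff_lt.1 (hg.lt_of_level_lt h)
  total h := (hg.total h).imp e.le_iff_le.1 e.le_iff_le.1
  eq_of_even h he := e.injective (hg.eq_of_even h he)

theorem IsBlowup.fiberSizes_eq_of_orderIso {P Q : Type*} [PartialOrder P] [PartialOrder Q]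
    [Finite P] {f : P → B22} {g : Q → B22} (hf : IsBlowup f) (hg : IsBlowup g) (e : P ≃o Q) {j : ℕ}
    {n m : B22 → ℕ} (hn : n ∈ fiberSizes j) (hm : m ∈ fiberSizes j)
    (hfn : ∀ t, Nat.card {u // f u = t} = n t) (hgm : ∀ t, Nat.card {u // g u = t} = m t) :
    n = m :=
  hf.fiberSizes_unique (hg.of_orderIso e) hn hm hfn fun t => by
    rw [← hgm t]
    exact Nat.card_congr (e.toEquiv.subtypeEquiv fun u => Iff.rfl)

theorem numUpToIso_blowups (j : ℕ) :
    numUpToIso {L : Lattice (Fin j) | ∃ f : Fin j → B22, @IsBlowup (Fin j) L.toPartialOrder f} =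
      (fiberSizes j).ncard := by
  choose L f hf hcard using fun n (hn : n ∈ fiberSizes j) => exists_lattice_of_fiberSizes hn
  symm
  refine Set.ncard_congr (fun n hn => Quotient.mk (isoSetoid j) (L n hn)) (fun n hn => ?_)
    (fun n m hn hm h => ?_) ?_
  · exact ⟨L n hn, ⟨f n hn, hf n hn⟩, rfl⟩
  · obtain ⟨e⟩ := Quotient.exact h
    exact @IsBlowup.fiberSizes_eq_of_orderIso (Fin j) (Fin j) (L n hn).toPartialOrder
      (L m hm).toPartialOrder _ (f n hn) (f m hm) (hf n hn) (hf m hm) e j n m hn hm (hcard n hn) (hcard m hm)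
  · rintro _ ⟨K, ⟨g, hg⟩, rfl⟩
    obtain ⟨n, hn, g', hg', hn'⟩ :=
      @IsBlowup.exists_fiberSizes (Fin j) K.toPartialOrder _ g hg
    rw [Nat.card_fin] at hn
    refine ⟨n, hn, Quotient.sound ?_⟩
    exact @IsBlowup.nonempty_orderIso_of_card_eq (Fin j) (L n hn).toPartialOrder (f n hn) (Fin j)
      K.toPartialOrder _ _ g' (hf n hn) hg' fun t => by rw [hcard n hn, hn']

/-! ### Counting the sorted fibre sizes. -/

theorem numPartitions_two (n : ℕ) : numPartitions n 2 = n / 2 := by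
  -- A partition into two parts is determined by its smaller part.
  have h : numPartitions n 2 = (Finset.Icc 1 (n / 2)).card := by
    symm
    refine Finset.card_bij (fun i hi => ⟨{i, n - i}, fun {k} hk => ?_, ?_⟩) (fun i hi => ?_)
      (fun i hi k hk h => ?_) (fun π hπ => ?_)
    · rw [Finset.mem_Icc] at hi
      simp only [Multiset.insert_eq_cons, Multiset.mem_cons, Multiset.mem_singleton] at hk
      omega
    · rw [Finset.mem_Icc] at hi
      simp only [Multiset.insert_eq_cons, Multiset.sum_cons, Multiset.sum_singleton]
      omega
    · simp
    · rw [Finset.mem_Icc] at hi hk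
      have h' := congrArg Nat.Partition.parts h
      have h2 : i ∈ ({k, n - k} : Multiset ℕ) := by
        rw [← show ({i, n - i} : Multiset ℕ) = {k, n - k} from h']
        simp
      simp only [Multiset.insert_eq_cons, Multiset.mem_cons, Multiset.mem_singleton] at h2
      omega
    · obtain ⟨a, b, hab⟩ := Multiset.card_eq_two.1 (Finset.mem_filter.1 hπ).2
      have ha : 0 < a := π.parts_pos (by rw [hab]; simp)
      have hb : 0 < b := π.parts_pos (by rw [hab]; simp)
      have hsum : a + b = n := by
        have := π.parts_sum
        rw [hab] at this
        simpa using this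
      rcases le_total a b with h | h
      · refine ⟨a, Finset.mem_Icc.2 (by omega), Nat.Partition.ext ?_⟩
        change ({a, n - a} : Multiset ℕ) = π.parts
        rw [hab, show n - a = b by omega]
      · refine ⟨b, Finset.mem_Icc.2 (by omega), Nat.Partition.ext ?_⟩
        change ({b, n - b} : Multiset ℕ) = π.parts
        rw [hab, show n - b = a by omega]
        exact Multiset.pair_comm b a
  rw [h, Nat.card_Icc, Nat.add_sub_cancel]

/-- The sequence of fibre sizes of a blowup with segments of sizes `m₁`, `m₂`, `m₃` and smaller
chains of sizes `i₁`, `i₂`, `i₃`. -/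
def sizesOf (m₁ m₂ m₃ : ℕ) (i : ℕ × ℕ × ℕ) : B22 → ℕ
  | .x => i.1
  | .c1 => m₁ - i.1
  | .y => i.2.1
  | .c2 => m₂ - i.2.1
  | .z => i.2.2
  | .c3 => m₃ - i.2.2
  | _ => 1

/-- Here `p` counts the elements from `r₁` to the top and `l` those from `r₁` to `r₂`, endpoints
included. The gaps thus have `j - p - 1`, `l - 2` and `p - l - 1` elements, and the summation bounds
say that each has at least two. -/
theorem ncard_fiberSizes (j : ℕ) : (fiberSizes j).ncard =
    ∑ p ∈ Finset.Icc 7 (j - 3), ∑ l ∈ Finset.Icc 4 (p - 3),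
      numPartitions (j - p - 1) 2 * numPartitions (l - 2) 2 * numPartitions (p - l - 1) 2 := by
  classical
  let I : Finset (Σ _ : ℕ, Σ _ : ℕ, ℕ × ℕ × ℕ) := (Finset.Icc 7 (j - 3)).sigma fun p =>
    (Finset.Icc 4 (p - 3)).sigma fun l => Finset.Icc 1 ((j - p - 1) / 2) ×ˢ
      (Finset.Icc 1 ((l - 2) / 2) ×ˢ Finset.Icc 1 ((p - l - 1) / 2))
  have hI : I.card = ∑ p ∈ Finset.Icc 7 (j - 3), ∑ l ∈ Finset.Icc 4 (p - 3),
      numPartitions (j - p - 1) 2 * numPartitions (l - 2) 2 * numPartitions (p - l - 1) 2 := by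
    simp only [I, Finset.card_sigma, Finset.card_product, Nat.card_Icc, Nat.add_sub_cancel,
      numPartitions_two, mul_assoc]
  have hmem : ∀ s : Σ _ : ℕ, Σ _ : ℕ, ℕ × ℕ × ℕ, s ∈ (I : Set _) ↔ (7 ≤ s.1 ∧ s.1 ≤ j - 3) ∧
      (4 ≤ s.2.1 ∧ s.2.1 ≤ s.1 - 3) ∧ (1 ≤ s.2.2.1 ∧ s.2.2.1 ≤ (j - s.1 - 1) / 2) ∧
      (1 ≤ s.2.2.2.1 ∧ s.2.2.2.1 ≤ (s.2.1 - 2) / 2) ∧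
      (1 ≤ s.2.2.2.2 ∧ s.2.2.2.2 ≤ (s.1 - s.2.1 - 1) / 2) := fun s => by
    simp only [I, Finset.mem_coe, Finset.mem_sigma, Finset.mem_product, Finset.mem_Icc]
  rw [← hI, ← Set.ncard_coe_finset]
  symm
  refine Set.ncard_congr (fun s _ => sizesOf (j - s.1 - 1) (s.2.1 - 2) (s.1 - s.2.1 - 1) s.2.2)
    (fun s hs => ?_) (fun s s' hs hs' h => ?_) (fun n hn => ?_)
  · rw [hmem] at hs
    refine ⟨fun t => ?_, fun t ht => ?_, ?_, ?_, ?_, ?_⟩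
    · cases t <;> simp only [sizesOf] <;> omega
    · cases t <;> first | rfl | exact absurd ht (by decide)
    · rw [B22.sum_univ]
      simp only [sizesOf]
      omega
    all_goals
      simp only [sizesOf]
      omega
  · rw [hmem] at hs hs'
    obtain ⟨p, l, i₁, i₂, i₃⟩ := s
    obtain ⟨p', l', k₁, k₂, k₃⟩ := s'
    have hx := congrFun h .x
    have hc1 := congrFun h .c1
    have hy := congrFun h .y
    have hc2 := congrFun h .c2
    have hz := congrFun h .z
    simp only [sizesOf] at hx hc1 hy hc2 hz hs hs'
    obtain rfl : p = p' := by omega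
    obtain rfl : l = l' := by omega
    subst hx hy hz
    rfl
  · obtain ⟨hpos, he, hsum, h1, h2, h3⟩ := hn
    have px := hpos .x
    have py := hpos .y
    have pz := hpos .z
    have e0 := he .zero (by decide)
    have ea := he .a (by decide)
    have eb := he .b (by decide)
    have e1 := he .one (by decide)
    rw [B22.sum_univ] at hsum
    refine ⟨⟨j - 1 - n .x - n .c1, n .y + n .c2 + 2, n .x, n .y, n .z⟩, (hmem _).2 ?_, ?_⟩
    · dsimp only
      omega
    · funext t
      cases t <;> simp only [sizesOf] <;> omega

end LatticeCount


theorem mainTheorem6 (j : ℕ) (hj : 10 ≤ j) :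
    numUpToIso (blocksOfHeight j 4 3 6) = numUpToIso (blocksB22 j) ∧
    numUpToIso (blocksB22 j) =
      ∑ p ∈ Finset.Icc 7 (j - 3), ∑ l ∈ Finset.Icc 4 (p - 3),
        numPartitions (j - p - 1) 2 * numPartitions (l - 2) 2 * numPartitions (p - l - 1) 2 := by
  rw [blocksOfHeight_eq, blocksB22_eq]
  exact ⟨rfl, (numUpToIso_blowups j).trans (ncard_fiberSizes j)⟩
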